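/- All spaces and algebras are complex; $\overline{\mathbb C}=\mathbb C\cup\{\infty\}$ is the Riemann sphere and $\overline{\mathbb C}^2=\overline{\mathbb C}\times\overline{\mathbb C}$. **Extended tensor product.** Let $X,Y$ be Banach spaces and let $X\boxtimes Y$ be an extended tensor product of them: a Banach space $X\boxtimes Y$ together with full (i.e. closed under taking inverses that exist in the ambient algebra), not necessarily closed, unital subalgebras $\mathbf B_0(X)\subseteq\mathbf B(X)$, $\mathbf B_0(Y)\subseteq\mathbf B(Y)$ and linear maps $X\otimes Y\to X\boxtimes Y$, $x\otimes y\mapsto x\boxtimes y$; $X^*\otimes Y^*\to(X\boxtimes Y)^*$, $x^*\otimes y^*\mapsto x^*\boxtimes y^*$; and a morphism of unital algebras $\mathbf B_0(X)\otimes\mathbf B_0(Y)\to\mathbf B(X\boxtimes Y)$, $A\otimes B\mapsto A\boxtimes B$, such that $\|x\boxtimes y\|=\|x\|\|y\|$, $\langle x\boxtimes y,x^*\boxtimes y^*\rangle=\langle x,x^*\rangle\langle y,y^*\rangle$, $\|x^*\boxtimes y^*\|=\|x^*\|\|y^*\|$, $(A\boxtimes B)(x\boxtimes y)=Ax\boxtimes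 By$, $(A\boxtimes B)^*(x^*\boxtimes y^*)=A^*x^*\boxtimes B^*y^*$ and $\|A\boxtimes B\|=\|A\|\|B\|$. **Pseudo-resolvents.** A maximal pseudo-resolvent in an algebra is a function $\lambda\mapsto R_\lambda$ on a set $\rho(R)\subseteq\mathbb C$, with values in the algebra, satisfying $R_\lambda-R_\mu=-(\lambda-\mu)R_\lambda R_\mu$ and having no extension to a larger subset of $\mathbb C$ with this property. Its extended regular set is $\rho(R)$, together with $\infty$ if $\rho(R)$ contains a deleted neighbourhood of $\infty$ and $\lambda R_\lambda\to\mathbf 1$ as $\lambda\to\infty$; the complement in $\overline{\mathbb C}$ is the extended singular set $\bar\sigma(R)$. A sequence $R_n$ of maximal pseudo-resolvents converges to a maximal pseudo-resolvent $R$ if there is $\mu\in\rho(R)$ with $\mu\in\rho(R_n)$ for all large $n$ and $R_{n,\mu}\to R_\mu$ in norm. **The resolvent of a function.** Let $U\subseteq\overline{\mathbb C}^2$ be open and let $f:U\to\overline{\mathbb C}$ be meromorphic without points of indeterminacy (so that $f$ is analytic off a nowhere dense relatively closed set $M$ of poles, near each of which $f$ is a quotient of analytic functions with denominator vanishing exactly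 on $M$ and numerator nonzero at the pole; $f=\infty$ on $M$). For maximal pseudo-resolvents $Q_1$ in $\mathbf B_0(X)$ and $Q_2$ in $\mathbf B_0(Y)$, the resolvent of $f$ is defined at those $\nu\in\mathbb C$ for which $\bar\sigma(Q_1)\times\bar\sigma(Q_2)\subseteq U$ and $\nu\notin f(\bar\sigma(Q_1)\times\bar\sigma(Q_2))$, and is then $$\begin{aligned}S_\nu(Q_1,Q_2)&=\frac1{(2\pi i)^2}\int_{\Gamma_1}\int_{\Gamma_2}\frac{1}{\nu-f(\lambda,\mu)}\,Q_{1,\lambda}\boxtimes Q_{2,\mu}\,d\mu\,d\lambda+\frac{\delta_2}{2\pi i}\int_{\Gamma_1}\frac{1}{\nu-f(\lambda,\infty)}\,Q_{1,\lambda}\boxtimes\mathbf 1\,d\lambda\\&\quad+\frac{\delta_1}{2\pi i}\int_{\Gamma_2}\frac{1}{\nu-f(\infty,\mu)}\,\mathbf 1\boxtimes Q_{2,\mu}\,d\mu+\frac{\delta_1\delta_2}{\nu-f(\infty,\infty)}\,\mathbf 1\boxtimes\mathbf 1 ,\end{aligned}$$ where $1/(\nu-\infty)=0$, $\Gamma_i$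 is an oriented envelope of $\bar\sigma(Q_i)$ with respect to $\overline{\mathbb C}\setminus U_i$ (a cycle of continuously differentiable arcs in $\mathbb C$ that meets neither set and surrounds the points of $\bar\sigma(Q_i)$ once and those of $\overline{\mathbb C}\setminus U_i$ zero times), $U_1\times U_2\supseteq\bar\sigma(Q_1)\times\bar\sigma(Q_2)$ is an open subset of $\{z\in U: f(z)\ne\nu\}$, and $\delta_i=1$ if $\Gamma_i$ encloses $\infty$ (winding numbers being then increased by $1$, and $\infty$ counted as surrounded once), $\delta_i=0$ otherwise. **Corollary.** Let $R_1$ and $R_2$ be maximal pseudo-resolvents in $\mathbf B_0(X)$ and $\mathbf B_0(Y)$, and let $f$ be meromorphic without points of indeterminacy in an open neighbourhood $U\subseteq\overline{\mathbb C}^2$ of $\bar\sigma(R_1)\times\bar\sigma(R_2)$. Let the sequences $R_{n,1}$ and $R'_{n,1}$ of maximal pseudo-resolvents in $\mathbf B_0(X)$ converge to $R_1$, and let the sequences $R_{n,2}$ and $R'_{n,2}$ of maximal pseudo-resolvents in $\mathbf B_0(Y)$ converge to $R_2$. Then for every $\nu\in\mathbb C\setminus f(\bar\sigma(R_1)\times\bar\sigma(R_2))$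 the operators $S_\nu(R_{n,1},R_{n,2})$ and $S_\nu(R'_{n,1},R'_{n,2})$ are defined for all large $n$, and both sequences converge in norm to the same operator $S_\nu(R_1,R_2)$. Here the operators $S_\nu$ are well defined: admissible contours exist, and the formula gives the same operator for all of them. (So the definition of $f(A,B)$ for unbounded $A,B$ through approximating sequences does not depend on these sequences, which answers a question of Reed and Simon.) -/

import Mathlib

open Filter Topology TensorProduct

namespace TwoVarCalculus

/-! ### Extended tensor products -/

/-- A unital subalgebra is full if it contains the inverse of each of its elements that is
invertible in the ambient algebra. -/
def IsFullSubalgebra {A : Type*} [Ring A] [Algebra ℂ A] (S : Subalgebra ℂ A) : Prop :=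
  ∀ a ∈ S, ∀ b : A, a * b = 1 → b * a = 1 → b ∈ S

/-- An extended tensor product of Banach spaces `X` and `Y`: a Banach space `Z` (written
`X ⊠ Y` on paper), full unital subalgebras `BX` of `B(X)` and `BY` of `B(Y)` (not necessarily
closed), and maps `j`, `J`, `K` giving `x ⊠ y`, `x* ⊠ y*` and `A ⊠ B` respectively. -/
structure ExtendedTensorProduct (X Y Z : Type*)
    [NormedAddCommGroup X] [NormedSpace ℂ X] [CompleteSpace X]
    [NormedAddCommGroup Y] [NormedSpace ℂ Y] [CompleteSpace Y]
    [NormedAddCommGroup Z] [NormedSpace ℂ Z] [CompleteSpace Z] where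
  BX : Subalgebra ℂ (X →L[ℂ] X)
  BY : Subalgebra ℂ (Y →L[ℂ] Y)
  full_BX : IsFullSubalgebra BX
  full_BY : IsFullSubalgebra BY
  j : X ⊗[ℂ] Y →ₗ[ℂ] Z
  norm_j : ∀ (x : X) (y : Y), ‖j (x ⊗ₜ[ℂ] y)‖ = ‖x‖ * ‖y‖
  J : (X →L[ℂ] ℂ) ⊗[ℂ] (Y →L[ℂ] ℂ) →ₗ[ℂ] (Z →L[ℂ] ℂ)
  J_apply : ∀ (x' : X →L[ℂ] ℂ) (y' : Y →L[ℂ] ℂ) (x : X) (y : Y),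
    J (x' ⊗ₜ[ℂ] y') (j (x ⊗ₜ[ℂ] y)) = x' x * y' y
  norm_J : ∀ (x' : X →L[ℂ] ℂ) (y' : Y →L[ℂ] ℂ), ‖J (x' ⊗ₜ[ℂ] y')‖ = ‖x'‖ * ‖y'‖
  K : BX ⊗[ℂ] BY →ₐ[ℂ] (Z →L[ℂ] Z)
  K_apply : ∀ (A : BX) (B : BY) (x : X) (y : Y),
    K (A ⊗ₜ[ℂ] B) (j (x ⊗ₜ[ℂ] y)) =
      j ((A : X →L[ℂ] X) x ⊗ₜ[ℂ] (B : Y →L[ℂ] Y) y)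
  /-- `(A ⊠ B)* (x* ⊠ y*) = (A* x*) ⊠ (B* y*)`. -/
  K_adjoint : ∀ (A : BX) (B : BY) (x' : X →L[ℂ] ℂ) (y' : Y →L[ℂ] ℂ),
    (J (x' ⊗ₜ[ℂ] y')).comp (K (A ⊗ₜ[ℂ] B)) =
      J (x'.comp (A : X →L[ℂ] X) ⊗ₜ[ℂ] y'.comp (B : Y →L[ℂ] Y))
  norm_K : ∀ (A : BX) (B : BY), ‖K (A ⊗ₜ[ℂ] B)‖ = ‖A‖ * ‖B‖

/-! ### Pseudo-resolvents -/

/-- The Hilbert identity on `D`. -/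
def IsPseudoResolventOn {A : Type*} [Ring A] [Algebra ℂ A] (R : ℂ → A) (D : Set ℂ) : Prop :=
  ∀ l ∈ D, ∀ m ∈ D, R l - R m = -((l - m) • (R l * R m))

/-- A maximal pseudo-resolvent in a unital algebra `A`: its domain is `regularSet`, and it has no
extension to a larger set that satisfies the Hilbert identity. The values of `toFun` outside
`regularSet` carry no meaning. -/
structure MaximalPseudoResolvent (A : Type*) [Ring A] [Algebra ℂ A] where
  regularSet : Set ℂ
  toFun : ℂ → A
  hilbert : IsPseudoResolventOn toFun regularSet
  maximal : ∀ (D : Set ℂ) (R' : ℂ → A), regularSet ⊆ D → IsPseudoResolventOn R' D →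
    Set.EqOn R' toFun regularSet → D = regularSet

namespace MaximalPseudoResolvent

variable {A : Type*} [NormedRing A] [NormedAlgebra ℂ A]

/-- The extended regular set: the regular set, together with `∞` if the pseudo-resolvent is defined
near `∞` and `λ R_λ → 1` as `λ → ∞`. -/
def extendedRegularSet (R : MaximalPseudoResolvent A) : Set (OnePoint ℂ) :=
  {p | (∃ l ∈ R.regularSet, p = (l : OnePoint ℂ)) ∨
    (p = OnePoint.infty ∧ (∀ᶠ l in Bornology.cobounded ℂ, l ∈ R.regularSet) ∧
      Tendsto (fun l : ℂ => l • R.toFun l) (Bornology.cobounded ℂ) (𝓝 1))}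

/-- The extended singular set. -/
def extendedSingularSet (R : MaximalPseudoResolvent A) : Set (OnePoint ℂ) :=
  R.extendedRegularSetᶜ

/-- Convergence of maximal pseudo-resolvents: norm convergence at one point of the domain of the
limit, at which all but finitely many members of the sequence are defined. -/
def ConvergesTo (R : ℕ → MaximalPseudoResolvent A) (R₀ : MaximalPseudoResolvent A) : Prop :=
  ∃ m ∈ R₀.regularSet, (∀ᶠ n in atTop, m ∈ (R n).regularSet) ∧
    Tendsto (fun n => (R n).toFun m) atTop (𝓝 (R₀.toFun m))

end MaximalPseudoResolvent

/-! ### Analytic and meromorphic functions of two variables on the Riemann sphere -/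

/-- The standard local parameter of the Riemann sphere at `p`: `t ↦ c + t` at `p = c ∈ ℂ` and
`t ↦ 1 / t` (with `0 ↦ ∞`) at `p = ∞`. -/
noncomputable def localParam : OnePoint ℂ → ℂ → OnePoint ℂ
  | some c, t => ((c + t : ℂ) : OnePoint ℂ)
  | none, t => open Classical in if t = 0 then OnePoint.infty else ((t⁻¹ : ℂ) : OnePoint ℂ)

/-- `g` has a convergent power series in the standard local parameters at the point `z`. -/
def SphereAnalyticAt (g : OnePoint ℂ × OnePoint ℂ → ℂ) (z : OnePoint ℂ × OnePoint ℂ) : Prop :=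
  AnalyticAt ℂ (fun t : ℂ × ℂ => g (localParam z.1 t.1, localParam z.2 t.2)) 0

/-- On `V`, `f` is the quotient `p / q` of analytic functions, and `M` is the zero set of `q`;
`V` is a connected open neighbourhood of `z` in `U`. -/
structure IsLocalQuotient (f : OnePoint ℂ × OnePoint ℂ → OnePoint ℂ)
    (U M : Set (OnePoint ℂ × OnePoint ℂ)) (z : OnePoint ℂ × OnePoint ℂ)
    (V : Set (OnePoint ℂ × OnePoint ℂ)) (p q : OnePoint ℂ × OnePoint ℂ → ℂ) : Prop where
  isOpen : IsOpen V
  isConnected : IsConnected V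
  mem : z ∈ V
  subset : V ⊆ U
  analytic_p : ∀ w ∈ V, SphereAnalyticAt p w
  analytic_q : ∀ w ∈ V, SphereAnalyticAt q w
  zero_iff : ∀ w ∈ V, q w = 0 ↔ w ∈ M
  eq_div : ∀ w ∈ V, w ∉ M → f w = ((p w / q w : ℂ) : OnePoint ℂ)

/-- `f` is meromorphic on the open set `U` with polar set `M`. -/
structure IsMeromorphicWithPolarSet (f : OnePoint ℂ × OnePoint ℂ → OnePoint ℂ)
    (U M : Set (OnePoint ℂ × OnePoint ℂ)) : Prop where
  subset : M ⊆ U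
  closed : ∃ C : Set (OnePoint ℂ × OnePoint ℂ), IsClosed C ∧ M = U ∩ C
  nowhereDense : IsNowhereDense M
  analytic : ∀ z ∈ U, z ∉ M → ∃ g : OnePoint ℂ × OnePoint ℂ → ℂ,
    SphereAnalyticAt g z ∧ ∀ᶠ w in 𝓝 z, f w = ((g w : ℂ) : OnePoint ℂ)
  no_continuation : ∀ z ∈ M, ¬ ∃ g : OnePoint ℂ × OnePoint ℂ → ℂ,
    SphereAnalyticAt g z ∧ ∀ᶠ w in 𝓝 z, w ∉ M → f w = ((g w : ℂ) : OnePoint ℂ)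
  quotient : ∀ z ∈ M, ∃ V p q, IsLocalQuotient f U M z V p q

/-- A point `z` of the polar set is a pole, rather than a point of indeterminacy, if the numerator
of some local quotient does not vanish at `z`; the value of `f` at a pole is `∞`. -/
def IsPole (f : OnePoint ℂ × OnePoint ℂ → OnePoint ℂ)
    (U M : Set (OnePoint ℂ × OnePoint ℂ)) (z : OnePoint ℂ × OnePoint ℂ) : Prop :=
  (∃ V p q, IsLocalQuotient f U M z V p q ∧ p z ≠ 0) ∧ f z = OnePoint.infty

/-- `f` is meromorphic on `U` and has no points of indeterminacy in `U`. -/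
def IsMeromorphicWithoutIndeterminacy (f : OnePoint ℂ × OnePoint ℂ → OnePoint ℂ)
    (U : Set (OnePoint ℂ × OnePoint ℂ)) : Prop :=
  ∃ M, IsMeromorphicWithPolarSet f U M ∧ ∀ z ∈ M, IsPole f U M z

/-- The function `1 / (ν - f)`, which is `0` where `f = ∞`. -/
noncomputable def recipSub (f : OnePoint ℂ × OnePoint ℂ → OnePoint ℂ) (ν : ℂ)
    (z : OnePoint ℂ × OnePoint ℂ) : ℂ :=
  match f z with
  | some w => (ν - w)⁻¹
  | none => 0

/-! ### Contours -/

/-- A contour in `ℂ`: finitely many continuously differentiable arcs, parametrized by `[0, 1]`,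
which join up to closed curves (the arc `i` ends where the arc `next i` starts), together with the
information whether the contour is regarded as enclosing the point `∞`. There may be no arcs. -/
structure Contour where
  count : ℕ
  arc : Fin count → ℝ → ℂ
  smooth : ∀ i, ContDiff ℝ 1 (arc i)
  next : Equiv.Perm (Fin count)
  closed : ∀ i, arc i 1 = arc (next i) 0
  enclosesInfty : Bool

namespace Contour

/-- `1` if the contour encloses `∞`, and `0` otherwise. -/
def delta (Γ : Contour) : ℂ := if Γ.enclosesInfty then 1 else 0

/-- The points of the contour. -/
def trace (Γ : Contour) : Set ℂ := {z | ∃ i, ∃ t ∈ Set.Icc (0 : ℝ) 1, z = Γ.arc i t}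

/-- The contour integral `∫_Γ F(z) dz`. -/
noncomputable def integral {E : Type*} [NormedAddCommGroup E] [NormedSpace ℂ E]
    (Γ : Contour) (F : ℂ → E) : E :=
  ∑ i, ∫ t in (0 : ℝ)..1, deriv (Γ.arc i) t • F (Γ.arc i t)

/-- The number of times the contour surrounds a point of the Riemann sphere: the winding number
if `∞` is not enclosed; if `∞` is enclosed, the winding number plus `1`, so that the outside of a
clockwise circle is surrounded once. -/
noncomputable def encloses (Γ : Contour) : OnePoint ℂ → ℂ
  | some z => Γ.delta + (2 * Real.pi * Complex.I)⁻¹ * Γ.integral (fun w => (w - z)⁻¹)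
  | none => Γ.delta

/-- `Γ` is an oriented envelope of `σ` with respect to `τ`: it does not meet these sets, surrounds
each point of `σ` once and each point of `τ` zero times. -/
structure IsOrientedEnvelope (Γ : Contour) (σ τ : Set (OnePoint ℂ)) : Prop where
  trace_avoids : ∀ z ∈ Γ.trace, (z : OnePoint ℂ) ∉ σ ∪ τ
  encloses_one : ∀ p ∈ σ, Γ.encloses p = 1
  encloses_zero : ∀ p ∈ τ, Γ.encloses p = 0

end Contour

/-! ### The resolvent of a function of two pseudo-resolvents -/

/-- The numbers `ν` at which the resolvent of `f` is defined: the neighbourhood `U` contains the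
product of the extended singular sets, and `f` does not take the value `ν` on this product. -/
def resolventDomain {A B : Type*} [NormedRing A] [NormedAlgebra ℂ A]
    [NormedRing B] [NormedAlgebra ℂ B]
    (f : OnePoint ℂ × OnePoint ℂ → OnePoint ℂ) (U : Set (OnePoint ℂ × OnePoint ℂ))
    (R₁ : MaximalPseudoResolvent A) (R₂ : MaximalPseudoResolvent B) : Set ℂ :=
  {ν | R₁.extendedSingularSet ×ˢ R₂.extendedSingularSet ⊆ U ∧
    (ν : OnePoint ℂ) ∉ f '' (R₁.extendedSingularSet ×ˢ R₂.extendedSingularSet)}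

/-- `Γ₁` and `Γ₂` are oriented envelopes of the extended singular sets with respect to the
complements of `U₁` and `U₂`, where `U₁ × U₂` is some open neighbourhood of the product of the
extended singular sets on which `1 / (ν - f)` is analytic. -/
def AdmissibleContours {A B : Type*} [NormedRing A] [NormedAlgebra ℂ A]
    [NormedRing B] [NormedAlgebra ℂ B]
    (f : OnePoint ℂ × OnePoint ℂ → OnePoint ℂ) (U : Set (OnePoint ℂ × OnePoint ℂ))
    (R₁ : MaximalPseudoResolvent A) (R₂ : MaximalPseudoResolvent B) (ν : ℂ)
    (Γ₁ Γ₂ : Contour) : Prop :=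
  ∃ U₁ U₂ : Set (OnePoint ℂ), IsOpen U₁ ∧ IsOpen U₂ ∧
    R₁.extendedSingularSet ⊆ U₁ ∧ R₂.extendedSingularSet ⊆ U₂ ∧
    U₁ ×ˢ U₂ ⊆ {z | z ∈ U ∧ f z ≠ (ν : OnePoint ℂ)} ∧
    Γ₁.IsOrientedEnvelope R₁.extendedSingularSet U₁ᶜ ∧
    Γ₂.IsOrientedEnvelope R₂.extendedSingularSet U₂ᶜ

namespace ExtendedTensorProduct

variable {X Y Z : Type*}
  [NormedAddCommGroup X] [NormedSpace ℂ X] [CompleteSpace X]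
  [NormedAddCommGroup Y] [NormedSpace ℂ Y] [CompleteSpace Y]
  [NormedAddCommGroup Z] [NormedSpace ℂ Z] [CompleteSpace Z]

/-- The functional calculus of two variables, computed with the contours `Γ₁` and `Γ₂`:
`(2πi)⁻² ∫_Γ₁ ∫_Γ₂ h(λ, μ) R₁(λ) ⊠ R₂(μ) dμ dλ + δ₂ (2πi)⁻¹ ∫_Γ₁ h(λ, ∞) R₁(λ) ⊠ 1 dλ
+ δ₁ (2πi)⁻¹ ∫_Γ₂ h(∞, μ) 1 ⊠ R₂(μ) dμ + δ₁ δ₂ h(∞, ∞) 1 ⊠ 1`. -/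
noncomputable def calculus (E : ExtendedTensorProduct X Y Z)
    (R₁ : MaximalPseudoResolvent E.BX) (R₂ : MaximalPseudoResolvent E.BY)
    (h : OnePoint ℂ × OnePoint ℂ → ℂ) (Γ₁ Γ₂ : Contour) : Z →L[ℂ] Z :=
  ((2 * Real.pi * Complex.I) ^ 2)⁻¹ •
      Γ₁.integral (fun l => Γ₂.integral (fun m =>
        h ((l : OnePoint ℂ), (m : OnePoint ℂ)) • E.K (R₁.toFun l ⊗ₜ[ℂ] R₂.toFun m))) +
    (Γ₂.delta * (2 * Real.pi * Complex.I)⁻¹) •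
      Γ₁.integral (fun l =>
        h ((l : OnePoint ℂ), OnePoint.infty) • E.K (R₁.toFun l ⊗ₜ[ℂ] 1)) +
    (Γ₁.delta * (2 * Real.pi * Complex.I)⁻¹) •
      Γ₂.integral (fun m =>
        h (OnePoint.infty, (m : OnePoint ℂ)) • E.K (1 ⊗ₜ[ℂ] R₂.toFun m)) +
    (Γ₁.delta * Γ₂.delta * h (OnePoint.infty, OnePoint.infty)) • E.K (1 ⊗ₜ[ℂ] 1)

/-- `T` is the value at `ν` of the resolvent of `f`: there are admissible contours, and with all of
them the functional calculus takes `1 / (ν - f)` to `T`. -/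
def IsResolventOfFunction (E : ExtendedTensorProduct X Y Z)
    (f : OnePoint ℂ × OnePoint ℂ → OnePoint ℂ) (U : Set (OnePoint ℂ × OnePoint ℂ))
    (R₁ : MaximalPseudoResolvent E.BX) (R₂ : MaximalPseudoResolvent E.BY) (ν : ℂ)
    (T : Z →L[ℂ] Z) : Prop :=
  (∃ Γ₁ Γ₂, AdmissibleContours f U R₁ R₂ ν Γ₁ Γ₂) ∧
    ∀ Γ₁ Γ₂, AdmissibleContours f U R₁ R₂ ν Γ₁ Γ₂ →
      E.calculus R₁ R₂ (recipSub f ν) Γ₁ Γ₂ = T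

open Classical in
/-- The resolvent `S_ν(R₁, R₂)` of the function `f` of `R₁` and `R₂`. -/
noncomputable def resolventOfFunction (E : ExtendedTensorProduct X Y Z)
    (f : OnePoint ℂ × OnePoint ℂ → OnePoint ℂ) (U : Set (OnePoint ℂ × OnePoint ℂ))
    (R₁ : MaximalPseudoResolvent E.BX) (R₂ : MaximalPseudoResolvent E.BY) (ν : ℂ) :
    Z →L[ℂ] Z :=
  if h : ∃ T, E.IsResolventOfFunction f U R₁ R₂ ν T then h.choose else 0

/-- The resolvent of `f` of the members of two sequences of pseudo-resolvents converges to that of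
the limits at `ν`: it is defined at `ν` for all large indices, and converges in norm. -/
def ResolventConvergesAt (E : ExtendedTensorProduct X Y Z)
    (f : OnePoint ℂ × OnePoint ℂ → OnePoint ℂ) (U : Set (OnePoint ℂ × OnePoint ℂ))
    (Q₁ : ℕ → MaximalPseudoResolvent E.BX) (Q₂ : ℕ → MaximalPseudoResolvent E.BY)
    (R₁ : MaximalPseudoResolvent E.BX) (R₂ : MaximalPseudoResolvent E.BY) (ν : ℂ) : Prop :=
  (∀ᶠ n in atTop, ν ∈ resolventDomain f U (Q₁ n) (Q₂ n) ∧
    E.IsResolventOfFunction f U (Q₁ n) (Q₂ n) ν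
      (E.resolventOfFunction f U (Q₁ n) (Q₂ n) ν)) ∧
  Tendsto (fun n => E.resolventOfFunction f U (Q₁ n) (Q₂ n) ν) atTop
    (𝓝 (E.resolventOfFunction f U R₁ R₂ ν))

end ExtendedTensorProduct

end TwoVarCalculus

open TwoVarCalculus

/-! Fix a base point m in the regular set of R. The Hilbert identity gives R_l = R_m (1 + (l - m)
R_m)⁻¹. By maximality and fullness, l is regular exactly when 1 + (l - m) R_m is invertible in the
ambient Banach algebra, and ∞ is extended regular exactly when R_m is (`mem_regularSet_iff`,
`infty_mem_iff_isUnit`). So R is governed by the single element R_m through inversion, which is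
continuous with open domain. Convergence at one point therefore gives convergence of R_{n,l'} to R_l
as n → ∞ and l' → l jointly (`tendsto_toFun`). As the sphere is compact, the extended singular sets
of the approximants also end up in any given neighbourhood of that of the limit
(`ConvergesTo.eventually_subset`).

Near a pole f = p/q with p nonzero, hence 1/(ν - f) = q/(νq - p). So 1/(ν - f) is analytic on the
set where f ≠ ν, and this set is open (`recipSub_spec`, `isOpen_ne`). The tube lemma supplies a
rectangle U₁ × U₂ in it, and grid contours supply an envelope in each factor
(`exists_isOrientedEnvelope`). Winding numbers are locally constant off the trace, so contours
chosen for the limit also serve for all late approximants (`isOpen_encloses_eq`). On these fixed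
contours the integrands converge uniformly, and `tendsto_bicalculus` passes to the limit. The limit
involves only R₁ and R₂, hence is the same for both pairs of sequences.

Independence of the contours is the homology form of Cauchy's theorem (`sum_smul_integral_eq_zero`),
applied in one variable at a time (`calculus_eq_calculus`), with Fubini exchanging the variables. If
two contours disagree about enclosing ∞, a large circle accounts for the extra term at ∞, because λ
R_λ → 1. Contours belonging to different rectangles are compared with an envelope relative to the
intersection (`calculus_eq_of_admissible`). -/

namespace TwoVarCalculus
namespace Contour

/-! ### Elementary properties of contour integrals. -/

variable {E : Type*} [NormedAddCommGroup E] [NormedSpace ℂ E]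

/-- The arc `i` of a contour, made constant outside `[0, 1]`. -/
noncomputable def point (Γ : Contour) (i : Fin Γ.count) (t : ℝ) : ℂ :=
  Γ.arc i (Set.projIcc (0 : ℝ) 1 zero_le_one t)

theorem point_mem_trace (Γ : Contour) (i : Fin Γ.count) (t : ℝ) : Γ.point i t ∈ Γ.trace :=
  ⟨i, _, (Set.projIcc (0 : ℝ) 1 zero_le_one t).2, rfl⟩

theorem continuous_point (Γ : Contour) (i : Fin Γ.count) : Continuous (Γ.point i) :=
  (Γ.smooth i).continuous.comp (continuous_subtype_val.comp continuous_projIcc)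

theorem continuous_deriv_arc (Γ : Contour) (i : Fin Γ.count) : Continuous (deriv (Γ.arc i)) :=
  (Γ.smooth i).continuous_deriv le_rfl

theorem point_eq_arc (Γ : Contour) (i : Fin Γ.count) {t : ℝ} (ht : t ∈ Set.uIcc (0 : ℝ) 1) :
    Γ.point i t = Γ.arc i t := by
  rw [Set.uIcc_of_le zero_le_one] at ht
  simp [point, Set.projIcc_of_mem _ ht]

theorem isCompact_trace (Γ : Contour) : IsCompact Γ.trace := by
  have : Γ.trace = ⋃ i, Γ.arc i '' Set.Icc (0 : ℝ) 1 := by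
    ext z
    simp only [trace, Set.mem_ofPred_eq, Set.mem_iUnion, Set.mem_image, eq_comm]
  rw [this]
  exact isCompact_iUnion fun i => isCompact_Icc.image (Γ.smooth i).continuous

/-- With `point` in place of the arc, an integrand that is continuous only on the trace becomes
continuous on all of ℝ, so integrability needs no restriction to [0, 1]. -/
theorem integral_eq (Γ : Contour) (F : ℂ → E) :
    Γ.integral F = ∑ i, ∫ t in (0 : ℝ)..1, deriv (Γ.arc i) t • F (Γ.point i t) :=
  Finset.sum_congr rfl fun i _ => intervalIntegral.integral_congr fun t ht => by
    simp only [Γ.point_eq_arc i ht]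

theorem integral_congr (Γ : Contour) {F G : ℂ → E} (h : Set.EqOn F G Γ.trace) :
    Γ.integral F = Γ.integral G := by
  simp only [integral_eq]
  exact Finset.sum_congr rfl fun i _ => intervalIntegral.integral_congr fun t _ => by
    simp only [h (Γ.point_mem_trace i t)]

theorem continuous_comp_point {T : Type*} [TopologicalSpace T] (Γ : Contour) {F : ℂ → T} (hF : ContinuousOn F Γ.trace)
    (i : Fin Γ.count) : Continuous fun t => F (Γ.point i t) :=
  hF.comp_continuous (Γ.continuous_point i) (Γ.point_mem_trace i)

theorem continuous_integrand (Γ : Contour) {F : ℂ → E} (hF : ContinuousOn F Γ.trace)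
    (i : Fin Γ.count) : Continuous fun t => deriv (Γ.arc i) t • F (Γ.point i t) :=
  (Γ.continuous_deriv_arc i).smul (Γ.continuous_comp_point hF i)

theorem integral_add (Γ : Contour) {F G : ℂ → E} (hF : ContinuousOn F Γ.trace)
    (hG : ContinuousOn G Γ.trace) :
    Γ.integral (fun z => F z + G z) = Γ.integral F + Γ.integral G := by
  simp only [integral_eq, ← Finset.sum_add_distrib, smul_add]
  exact Finset.sum_congr rfl fun i _ => intervalIntegral.integral_add
    ((Γ.continuous_integrand hF i).intervalIntegrable _ _)
    ((Γ.continuous_integrand hG i).intervalIntegrable _ _)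

theorem integral_smul (Γ : Contour) (c : ℂ) (F : ℂ → E) :
    Γ.integral (fun z => c • F z) = c • Γ.integral F := by
  simp only [integral, Finset.smul_sum, ← intervalIntegral.integral_smul]
  simp only [smul_comm c]

theorem integral_sub (Γ : Contour) {F G : ℂ → E} (hF : ContinuousOn F Γ.trace)
    (hG : ContinuousOn G Γ.trace) :
    Γ.integral (fun z => F z - G z) = Γ.integral F - Γ.integral G := by
  simp only [integral_eq, ← Finset.sum_sub_distrib, smul_sub]
  exact Finset.sum_congr rfl fun i _ => intervalIntegral.integral_sub
    ((Γ.continuous_integrand hF i).intervalIntegrable _ _)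
    ((Γ.continuous_integrand hG i).intervalIntegrable _ _)

theorem integral_sum {ι : Type*} (s : Finset ι) (Γ : Contour) {F : ι → ℂ → E}
    (hF : ∀ k ∈ s, ContinuousOn (F k) Γ.trace) :
    Γ.integral (fun z => ∑ k ∈ s, F k z) = ∑ k ∈ s, Γ.integral (F k) := by
  simp only [integral_eq]
  rw [Finset.sum_comm]
  refine Finset.sum_congr rfl fun i _ => ?_
  simp only [Finset.smul_sum]
  exact intervalIntegral.integral_finsetSum fun k hk =>
    (Γ.continuous_integrand (hF k hk) i).intervalIntegrable _ _

theorem integral_clm {E' : Type*} [NormedAddCommGroup E'] [NormedSpace ℂ E']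
    [CompleteSpace E] [CompleteSpace E']
    (Γ : Contour) (L : E →L[ℂ] E') {F : ℂ → E} (hF : ContinuousOn F Γ.trace) :
    Γ.integral (fun z => L (F z)) = L (Γ.integral F) := by
  simp only [integral_eq, map_sum]
  refine Finset.sum_congr rfl fun i _ => ?_
  rw [← L.intervalIntegral_comp_comm ((Γ.continuous_integrand hF i).intervalIntegrable _ _)]
  simp

/-- The length of a contour. -/
noncomputable def length (Γ : Contour) : ℝ := ∑ i, ∫ t in (0 : ℝ)..1, ‖deriv (Γ.arc i) t‖

theorem length_nonneg (Γ : Contour) : 0 ≤ Γ.length :=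
  Finset.sum_nonneg fun _ _ => intervalIntegral.integral_nonneg zero_le_one fun _ _ => norm_nonneg _

theorem norm_integral_le (Γ : Contour) {F : ℂ → E} {ε : ℝ} (h : ∀ z ∈ Γ.trace, ‖F z‖ ≤ ε) :
    ‖Γ.integral F‖ ≤ Γ.length * ε := by
  rw [integral_eq, length, Finset.sum_mul]
  refine norm_sum_le_of_le _ fun i _ => ?_
  rw [← intervalIntegral.integral_mul_const]
  refine intervalIntegral.norm_integral_le_of_norm_le zero_le_one ?_ ?_
  · refine Eventually.of_forall fun t _ => ?_
    rw [norm_smul]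
    exact mul_le_mul_of_nonneg_left (h _ (Γ.point_mem_trace i t)) (norm_nonneg _)
  · exact (((Γ.continuous_deriv_arc i).norm).mul continuous_const).intervalIntegrable _ _

/-- Each arc contributes the difference of the primitive at the starting points of its successor and
of itself; since `next` is a permutation, these differences add up to zero. -/
theorem integral_eq_zero_of_hasDerivAt [CompleteSpace E] (Γ : Contour) {g G : ℂ → E}
    (hg : ContinuousOn g Γ.trace)
    (hG : ∀ z ∈ Γ.trace, HasDerivAt G (g z) z) : Γ.integral g = 0 := by
  have key : ∀ i, ∫ t in (0 : ℝ)..1, deriv (Γ.arc i) t • g (Γ.arc i t) =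
      G (Γ.arc (Γ.next i) 0) - G (Γ.arc i 0) := by
    intro i
    rw [← Γ.closed i]
    refine intervalIntegral.integral_eq_sub_of_hasDerivAt (f := fun t => G (Γ.arc i t)) ?_ ?_
    · intro t ht
      rw [Set.uIcc_of_le zero_le_one] at ht
      have h1 : HasDerivAt (Γ.arc i) (deriv (Γ.arc i) t) t :=
        ((Γ.smooth i).differentiable one_ne_zero t).hasDerivAt
      exact (hG _ ⟨i, t, ht, rfl⟩).scomp t h1
    · refine ((Γ.continuous_integrand hg i).intervalIntegrable 0 1).congr ?_
      intro t ht
      simp only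
      rw [Γ.point_eq_arc i (Set.uIoc_subset_uIcc ht)]
  rw [integral, Finset.sum_congr rfl fun i _ => key i, Finset.sum_sub_distrib,
    Equiv.sum_comp Γ.next (fun i => G (Γ.arc i 0)), sub_self]

theorem continuousOn_integral {T : Type*} [TopologicalSpace T] {s : Set T} (Γ : Contour)
    {F : T → ℂ → E} (hF : ContinuousOn (Function.uncurry F) (s ×ˢ Γ.trace)) :
    ContinuousOn (fun x => Γ.integral (F x)) s := by
  simp only [integral_eq]
  refine continuousOn_finsetSum _ fun i _ => ?_
  rw [continuousOn_iff_continuous_domRestrict]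
  refine intervalIntegral.continuous_parametric_intervalIntegral_of_continuous'
    (f := fun (x : s) t => deriv (Γ.arc i) t • F x (Γ.point i t)) ?_ 0 1
  refine ((Γ.continuous_deriv_arc i).comp continuous_snd).smul ?_
  exact hF.comp_continuous (f := fun p : s × ℝ => ((p.1 : T), Γ.point i p.2))
    (by have := Γ.continuous_point i; fun_prop) fun p => ⟨p.1.2, Γ.point_mem_trace i _⟩

theorem intervalIntegral_swap [CompleteSpace E] {f : ℝ → ℝ → E} (hf : Continuous (Function.uncurry f)) :
    ∫ s in (0 : ℝ)..1, ∫ t in (0 : ℝ)..1, f s t = ∫ t in (0 : ℝ)..1, ∫ s in (0 : ℝ)..1, f s t := by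
  simp only [intervalIntegral.integral_of_le zero_le_one]
  refine MeasureTheory.integral_integral_swap ?_
  rw [MeasureTheory.Measure.prod_restrict]
  exact (hf.continuousOn.integrableOn_compact (isCompact_Icc.prod isCompact_Icc)).mono_set
    (Set.prod_mono Set.Ioc_subset_Icc_self Set.Ioc_subset_Icc_self)

theorem integral_integral_swap [CompleteSpace E] (Γ Γ' : Contour) {F : ℂ → ℂ → E}
    (hF : ContinuousOn (Function.uncurry F) (Γ.trace ×ˢ Γ'.trace)) :
    Γ.integral (fun z => Γ'.integral (F z)) = Γ'.integral (fun w => Γ.integral fun z => F z w) := by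
  have hc : ∀ i j, Continuous fun p : ℝ × ℝ =>
      deriv (Γ.arc i) p.1 • deriv (Γ'.arc j) p.2 • F (Γ.point i p.1) (Γ'.point j p.2) := by
    intro i j
    have h1 := Γ.continuous_deriv_arc i
    have h2 := Γ'.continuous_deriv_arc j
    have h3 : Continuous fun p : ℝ × ℝ => F (Γ.point i p.1) (Γ'.point j p.2) :=
      hF.comp_continuous (f := fun p : ℝ × ℝ => (Γ.point i p.1, Γ'.point j p.2))
        (by have := Γ.continuous_point i; have := Γ'.continuous_point j; fun_prop)
        fun p => ⟨Γ.point_mem_trace i _, Γ'.point_mem_trace j _⟩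
    exact (h1.comp continuous_fst).smul ((h2.comp continuous_snd).smul h3)
  have e1 : Γ.integral (fun z => Γ'.integral (F z)) = ∑ i, ∑ j, ∫ s in (0 : ℝ)..1,
      ∫ t in (0 : ℝ)..1, deriv (Γ.arc i) s • deriv (Γ'.arc j) t • F (Γ.point i s) (Γ'.point j t) := by
    simp only [integral_eq, Finset.smul_sum, ← intervalIntegral.integral_smul]
    refine Finset.sum_congr rfl fun i _ => intervalIntegral.integral_finsetSum fun j _ => ?_
    exact (intervalIntegral.continuous_parametric_intervalIntegral_of_continuous'
      (hc i j) 0 1).intervalIntegrable _ _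
  have e2 : Γ'.integral (fun w => Γ.integral fun z => F z w) = ∑ i, ∑ j, ∫ t in (0 : ℝ)..1,
      ∫ s in (0 : ℝ)..1, deriv (Γ.arc i) s • deriv (Γ'.arc j) t • F (Γ.point i s) (Γ'.point j t) := by
    simp only [integral_eq, Finset.smul_sum, ← intervalIntegral.integral_smul]
    rw [Finset.sum_comm]
    refine Finset.sum_congr rfl fun j _ => ?_
    rw [intervalIntegral.integral_finsetSum fun i _ => ?_]
    · simp only [smul_comm (deriv (Γ'.arc j) _)]
    · have := intervalIntegral.continuous_parametric_intervalIntegral_of_continuous'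
        (f := fun t s => deriv (Γ.arc i) s • deriv (Γ'.arc j) t • F (Γ.point i s) (Γ'.point j t))
        (μ := MeasureTheory.volume) ((hc i j).comp continuous_swap) 0 1
      simp only [smul_comm (deriv (Γ'.arc j) _)]
      exact this.intervalIntegrable _ _
  rw [e1, e2]
  exact Finset.sum_congr rfl fun i _ => Finset.sum_congr rfl fun j _ => intervalIntegral_swap (hc i j)

/-! ### Winding numbers -/

/-- The winding integral `∫_Γ dw / (w - z)`. -/
noncomputable def winding (Γ : Contour) (z : ℂ) : ℂ := Γ.integral fun w => (w - z)⁻¹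

theorem encloses_coe (Γ : Contour) (z : ℂ) :
    Γ.encloses (z : OnePoint ℂ) = Γ.delta + (2 * Real.pi * Complex.I)⁻¹ * Γ.winding z := rfl

theorem encloses_infty (Γ : Contour) : Γ.encloses OnePoint.infty = Γ.delta := rfl

theorem continuousOn_inv_sub {s : Set ℂ} {z : ℂ} (hz : z ∉ s) :
    ContinuousOn (fun w : ℂ => (w - z)⁻¹) s :=
  ContinuousOn.inv₀ (by fun_prop) fun w hw h => hz (by rwa [← sub_eq_zero.1 h])

/-- The difference of the two kernels has the primitive log((w - z)/(w - z₀)). On the trace the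
quotient lies in the unit disc about 1, away from the branch cut. -/
theorem winding_eq_of_norm_lt (Γ : Contour) {z z₀ : ℂ}
    (h : ∀ w ∈ Γ.trace, ‖z - z₀‖ < ‖w - z₀‖) : Γ.winding z = Γ.winding z₀ := by
  have hz : z ∉ Γ.trace := fun hz => lt_irrefl _ (h z hz)
  have hz₀ : z₀ ∉ Γ.trace := fun hz => by
    have := h _ hz
    rw [sub_self, norm_zero] at this
    exact absurd this (not_lt.2 (norm_nonneg _))
  rw [← sub_eq_zero, winding, winding, ← Γ.integral_sub (continuousOn_inv_sub hz)
    (continuousOn_inv_sub hz₀)]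
  refine Γ.integral_eq_zero_of_hasDerivAt
    ((continuousOn_inv_sub hz).sub (continuousOn_inv_sub hz₀))
    (G := fun w => Complex.log ((w - z) / (w - z₀))) fun w hw => ?_
  have h1 : w - z ≠ 0 := fun e => hz (by rwa [← sub_eq_zero.1 e])
  have h0 : w - z₀ ≠ 0 := fun e => hz₀ (by rwa [← sub_eq_zero.1 e])
  have hs : (w - z) / (w - z₀) ∈ Complex.slitPlane := by
    have e : (w - z) / (w - z₀) = 1 + -((z - z₀) / (w - z₀)) := by
      field_simp; ring
    rw [e]
    refine Complex.mem_slitPlane_of_norm_lt_one ?_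
    rw [norm_neg, norm_div, div_lt_one (norm_pos_iff.2 h0)]
    exact h w hw
  have hd : HasDerivAt (fun w => (w - z) / (w - z₀))
      ((1 * (w - z₀) - (w - z) * 1) / (w - z₀) ^ 2) w :=
    ((hasDerivAt_id w).sub_const z).fun_div ((hasDerivAt_id w).sub_const z₀) h0
  convert! hd.clog hs using 1
  field_simp

/-- Here log(1 - w/z) is a primitive of the kernel on the trace. -/
theorem winding_eq_zero_of_norm_lt (Γ : Contour) {z : ℂ} (h : ∀ w ∈ Γ.trace, ‖w‖ < ‖z‖) :
    Γ.winding z = 0 := by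
  have hz : z ∉ Γ.trace := fun hz => lt_irrefl _ (h z hz)
  refine Γ.integral_eq_zero_of_hasDerivAt (continuousOn_inv_sub hz)
    (G := fun w => Complex.log (1 + -(w / z))) fun w hw => ?_
  have h0 : z ≠ 0 := norm_pos_iff.1 ((norm_nonneg _).trans_lt (h w hw))
  have h1 : w - z ≠ 0 := fun e => hz (by rwa [← sub_eq_zero.1 e])
  have hs : 1 + -(w / z) ∈ Complex.slitPlane := by
    refine Complex.mem_slitPlane_of_norm_lt_one ?_
    rw [norm_neg, norm_div, div_lt_one (norm_pos_iff.2 h0)]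
    exact h w hw
  have hd : HasDerivAt (fun w => 1 + -(w / z)) (-(1 / z)) w :=
    (((hasDerivAt_id w).div_const z).neg).const_add 1
  convert! hd.clog hs using 1
  have : z - w ≠ 0 := fun e => h1 (by rw [← neg_sub, e, neg_zero])
  rw [show (1 : ℂ) + -(w / z) = (z - w) / z by field_simp; ring]
  field_simp
  rw [← neg_sub z w]; field_simp

theorem eventually_winding_eq (Γ : Contour) {z₀ : ℂ} (h : z₀ ∉ Γ.trace) :
    ∀ᶠ z in 𝓝 z₀, z ∉ Γ.trace ∧ Γ.winding z = Γ.winding z₀ := by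
  have ho : IsOpen (Γ.trace)ᶜ := Γ.isCompact_trace.isClosed.isOpen_compl
  obtain ⟨ε, hε, hb⟩ := Metric.isOpen_iff.1 ho z₀ h
  filter_upwards [Metric.ball_mem_nhds z₀ hε] with z hz
  refine ⟨hb hz, Γ.winding_eq_of_norm_lt fun w hw => ?_⟩
  rw [← dist_eq_norm, ← dist_eq_norm]
  refine (Metric.mem_ball.1 hz).trans_le ?_
  by_contra hlt
  exact hb (Metric.mem_ball.2 (not_le.1 hlt)) hw

theorem exists_norm_lt (Γ : Contour) : ∃ r : ℝ, 0 < r ∧ ∀ w ∈ Γ.trace, ‖w‖ < r := by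
  obtain ⟨r, hr, h⟩ := Γ.isCompact_trace.isBounded.exists_pos_norm_lt
  exact ⟨r, hr, h⟩

/-- Winding numbers are locally constant off the trace and vanish near ∞, where only `delta`
remains. With c = 1 this lets one contour envelop all singular sets close to a given one. -/
theorem isOpen_encloses_eq (Γ : Contour) (c : ℂ) :
    IsOpen {p : OnePoint ℂ | (∀ z ∈ Γ.trace, (z : OnePoint ℂ) ≠ p) ∧ Γ.encloses p = c} := by
  rw [isOpen_iff_mem_nhds]
  intro p
  induction p using OnePoint.rec with
  | infty =>
    rintro ⟨-, hc⟩
    obtain ⟨r, hr, hb⟩ := Γ.exists_norm_lt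
    rw [← Filter.eventually_mem_set, OnePoint.nhds_infty_eq, eventually_sup, eventually_map]
    refine ⟨?_, ⟨fun z _ => OnePoint.coe_ne_infty z, hc⟩⟩
    rw [coclosedCompact_eq_cocompact, ← Metric.cobounded_eq_cocompact,
      ← comap_norm_atTop]
    filter_upwards [tendsto_comap.eventually (eventually_gt_atTop r)] with z hz
    refine ⟨fun w hw e => ?_, ?_⟩
    · rw [OnePoint.coe_eq_coe.1 e] at hw
      exact absurd (hb z hw) (not_lt.2 hz.le)
    · rw [encloses_coe, Γ.winding_eq_zero_of_norm_lt fun w hw => (hb w hw).trans hz, mul_zero,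
        add_zero, ← encloses_infty, hc]
  | coe z₀ =>
    rintro ⟨h, hc⟩
    rw [← Filter.eventually_mem_set, OnePoint.nhds_coe_eq, eventually_map]
    filter_upwards [Γ.eventually_winding_eq fun hz => h z₀ hz rfl] with z hz
    refine ⟨fun w hw e => hz.1 (OnePoint.coe_eq_coe.1 e ▸ hw), ?_⟩
    rw [encloses_coe, hz.2, ← encloses_coe, hc]

end Contour
end TwoVarCalculus

namespace TwoVarCalculus

/-- A locally constant function on the connected interval [0, 1] takes equal values at the ends. -/
theorem Contour.winding_eq_of_segment (Γ : Contour) {z₀ z₁ : ℂ}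
    (h : ∀ s ∈ Set.Icc (0 : ℝ) 1, z₀ + s * (z₁ - z₀) ∉ Γ.trace) : Γ.winding z₀ = Γ.winding z₁ := by
  have hl : IsLocallyConstant fun s : Set.Icc (0 : ℝ) 1 => Γ.winding (z₀ + (s : ℝ) * (z₁ - z₀)) := by
    rw [IsLocallyConstant.iff_eventually_eq]
    intro s
    have hc : Continuous fun s : Set.Icc (0 : ℝ) 1 => z₀ + ((s : ℝ) : ℂ) * (z₁ - z₀) := by fun_prop
    filter_upwards [hc.continuousAt.eventually (Γ.eventually_winding_eq (h s s.2))] with t ht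
    exact ht.2
  have := hl.apply_eq_of_preconnectedSpace ⟨0, by simp⟩ ⟨1, by simp⟩
  simpa using this

/-! ### Grid contours -/

/-- The directions from a unit square to its lower, right, upper and left neighbours. -/
def gridDir : Fin 4 → ℤ × ℤ := ![(0, -1), (1, 0), (0, 1), (-1, 0)]

/-- The corners of the unit square, counterclockwise from the lower left one. -/
def gridOff : Fin 4 → ℤ × ℤ := ![(0, 0), (1, 0), (1, 1), (0, 1)]

theorem gridDir_add_two (d : Fin 4) : gridDir (d + 2) = -gridDir d := by
  revert d; decide

theorem gridDir_sub_one (d : Fin 4) : gridDir (d - 1) = -gridDir (d + 1) := by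
  revert d; decide

theorem gridOff_add_one (d : Fin 4) : gridOff (d + 1) = gridOff d + gridDir (d + 1) := by
  revert d; decide

/-- The sides of squares in `S` whose other adjacent square is not in `S`. -/
def gridBoundary (S : Finset (ℤ × ℤ)) : Finset ((ℤ × ℤ) × Fin 4) :=
  (S ×ˢ Finset.univ).filter fun e => e.1 + gridDir e.2 ∉ S

theorem mem_gridBoundary {S : Finset (ℤ × ℤ)} {e : (ℤ × ℤ) × Fin 4} :
    e ∈ gridBoundary S ↔ e.1 ∈ S ∧ e.1 + gridDir e.2 ∉ S := by
  simp [gridBoundary]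

/-- The successor of a boundary side, with the squares of `S` to the left. -/
def gridNext (S : Finset (ℤ × ℤ)) (e : (ℤ × ℤ) × Fin 4) : (ℤ × ℤ) × Fin 4 :=
  -- The walk turns left whenever the square ahead is missing, even if the square diagonally ahead
  -- belongs to S. This separates the two passages through a vertex where squares of S meet only at
  -- a corner.
  if e.1 + gridDir (e.2 + 1) ∈ S then
    if e.1 + gridDir (e.2 + 1) + gridDir e.2 ∈ S then
      (e.1 + gridDir (e.2 + 1) + gridDir e.2, e.2 - 1)
    else (e.1 + gridDir (e.2 + 1), e.2)
  else (e.1, e.2 + 1)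

/-- The predecessor of a boundary side. -/
def gridPrev (S : Finset (ℤ × ℤ)) (e : (ℤ × ℤ) × Fin 4) : (ℤ × ℤ) × Fin 4 :=
  if e.1 + gridDir (e.2 - 1) ∈ S then
    if e.1 + gridDir (e.2 - 1) + gridDir e.2 ∈ S then
      (e.1 + gridDir (e.2 - 1) + gridDir e.2, e.2 + 1)
    else (e.1 + gridDir (e.2 - 1), e.2)
  else (e.1, e.2 - 1)

theorem gridNext_mem {S : Finset (ℤ × ℤ)} {e : (ℤ × ℤ) × Fin 4} (he : e ∈ gridBoundary S) :
    gridNext S e ∈ gridBoundary S := by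
  rw [mem_gridBoundary] at he
  unfold gridNext
  split_ifs with h1 h2
  · refine mem_gridBoundary.2 ⟨h2, ?_⟩
    rw [gridDir_sub_one]
    rw [add_right_comm, add_neg_cancel_right]
    exact he.2
  · exact mem_gridBoundary.2 ⟨h1, h2⟩
  · exact mem_gridBoundary.2 ⟨he.1, h1⟩

/-- A left inverse suffices: on the finite set of boundary sides, injectivity already yields a
permutation. -/
theorem gridPrev_gridNext {S : Finset (ℤ × ℤ)} {e : (ℤ × ℤ) × Fin 4} (he : e ∈ gridBoundary S) :
    gridPrev S (gridNext S e) = e := by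
  rw [mem_gridBoundary] at he
  obtain ⟨q, d⟩ := e
  dsimp only at he
  unfold gridNext
  dsimp only
  split_ifs with h1 h2
  · have e1 : q + gridDir (d + 1) + gridDir d + gridDir (d - 1 - 1) = q + gridDir (d + 1) := by
      rw [(by decide : ∀ d : Fin 4, d - 1 - 1 = d + 2) d, gridDir_add_two]; abel
    have e2 : q + gridDir (d + 1) + gridDir (d - 1) = q := by
      rw [gridDir_sub_one]; abel
    simp [gridPrev, e1, e2, h1, he.1]
  · have e1 : q + gridDir (d + 1) + gridDir (d - 1) = q := by
      rw [gridDir_sub_one]; abel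
    simp [gridPrev, e1, he.1, he.2]
  · simp [gridPrev, he.2]

/-- The permutation of the boundary sides that maps each to its successor. -/
noncomputable def gridPerm (S : Finset (ℤ × ℤ)) : Equiv.Perm (gridBoundary S) :=
  Equiv.ofBijective (fun e => ⟨gridNext S e, gridNext_mem e.2⟩) <| by
    rw [← Finite.injective_iff_bijective]
    intro e e' h
    have h' : gridNext S e = gridNext S e' := congrArg Subtype.val h
    rw [Subtype.ext_iff, ← gridPrev_gridNext e.2, h', gridPrev_gridNext e'.2]

/-- The grid point with integer coordinates `p` in a grid of mesh `δ`. -/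
noncomputable def gridPoint (δ : ℝ) (p : ℤ × ℤ) : ℂ := ⟨δ * p.1, δ * p.2⟩

/-- The side number `d` of the square `q`, parametrized counterclockwise. -/
noncomputable def gridSide (δ : ℝ) (e : (ℤ × ℤ) × Fin 4) (t : ℝ) : ℂ :=
  gridPoint δ (e.1 + gridOff e.2) +
    t * (gridPoint δ (e.1 + gridOff (e.2 + 1)) - gridPoint δ (e.1 + gridOff e.2))

theorem gridSide_one (δ : ℝ) (e : (ℤ × ℤ) × Fin 4) :
    gridSide δ e 1 = gridPoint δ (e.1 + gridOff (e.2 + 1)) := by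
  simp [gridSide]

theorem gridSide_zero (δ : ℝ) (e : (ℤ × ℤ) × Fin 4) :
    gridSide δ e 0 = gridPoint δ (e.1 + gridOff e.2) := by
  simp [gridSide]

theorem gridSide_gridNext (δ : ℝ) (S : Finset (ℤ × ℤ)) (e : (ℤ × ℤ) × Fin 4) :
    gridSide δ e 1 = gridSide δ (gridNext S e) 0 := by
  rw [gridSide_one, gridSide_zero]
  unfold gridNext
  split_ifs with h1 h2
  · have h := gridOff_add_one (e.2 - 1)
    rw [sub_add_cancel] at h
    dsimp only
    rw [gridOff_add_one, h]
    congr 1; abel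
  · dsimp only
    rw [gridOff_add_one]
    congr 1; abel
  · rfl

theorem hasDerivAt_gridSide (δ : ℝ) (e : (ℤ × ℤ) × Fin 4) (t : ℝ) :
    HasDerivAt (gridSide δ e)
      (gridPoint δ (e.1 + gridOff (e.2 + 1)) - gridPoint δ (e.1 + gridOff e.2)) t := by
  unfold gridSide
  have := (((hasDerivAt_id t).ofReal_comp).mul_const
    (gridPoint δ (e.1 + gridOff (e.2 + 1)) - gridPoint δ (e.1 + gridOff e.2))).const_add
    (gridPoint δ (e.1 + gridOff e.2))
  simpa using this

/-- The oriented boundary of the union of the squares in `S`. -/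
noncomputable def gridContour (δ : ℝ) (S : Finset (ℤ × ℤ)) : Contour where
  count := (gridBoundary S).card
  arc i := gridSide δ ((gridBoundary S).equivFin.symm i)
  smooth i := by
    unfold gridSide
    have : ContDiff ℝ 1 (fun t : ℝ => (t : ℂ)) := Complex.ofRealCLM.contDiff
    fun_prop
  next := (gridBoundary S).equivFin.permCongr (gridPerm S)
  closed i := by
    rw [Equiv.permCongr_apply, Equiv.symm_apply_apply]
    exact gridSide_gridNext δ S _
  enclosesInfty := false

/-- The integral over a side of a square of the grid. -/
noncomputable def gridSideIntegral (δ : ℝ) (F : ℂ → ℂ) (e : (ℤ × ℤ) × Fin 4) : ℂ :=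
  ∫ t in (0 : ℝ)..1,
    (gridPoint δ (e.1 + gridOff (e.2 + 1)) - gridPoint δ (e.1 + gridOff e.2)) * F (gridSide δ e t)

theorem gridContour_integral (δ : ℝ) (S : Finset (ℤ × ℤ)) (F : ℂ → ℂ) :
    (gridContour δ S).integral F = ∑ e ∈ gridBoundary S, gridSideIntegral δ F e := by
  rw [← Finset.sum_coe_sort, ← Equiv.sum_comp (gridBoundary S).equivFin.symm]
  refine Finset.sum_congr rfl fun i _ => ?_
  refine intervalIntegral.integral_congr fun t _ => ?_
  simp only [smul_eq_mul]
  congr 1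
  exact (hasDerivAt_gridSide δ _ t).deriv

theorem gridOff_flip (d : Fin 4) : gridDir d + gridOff (d + 2) = gridOff (d + 1) ∧
    gridDir d + gridOff (d + 2 + 1) = gridOff d := by
  revert d; decide

theorem gridSideIntegral_flip (δ : ℝ) (F : ℂ → ℂ) (e : (ℤ × ℤ) × Fin 4) :
    gridSideIntegral δ F (e.1 + gridDir e.2, e.2 + 2) = -gridSideIntegral δ F e := by
  have h := intervalIntegral.integral_comp_sub_left (a := 0) (b := 1) (fun t =>
    (gridPoint δ (e.1 + gridOff (e.2 + 1)) - gridPoint δ (e.1 + gridOff e.2)) *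
      F (gridSide δ e t)) 1
  rw [sub_self, sub_zero] at h
  rw [gridSideIntegral, gridSideIntegral, ← h, ← intervalIntegral.integral_neg]
  refine intervalIntegral.integral_congr fun t _ => ?_
  dsimp only [gridSide]
  rw [add_assoc e.1, add_assoc e.1, (gridOff_flip e.2).1, (gridOff_flip e.2).2, ← neg_mul]
  congr 1
  · ring
  · congr 1
    push_cast
    ring

/-- A side between two squares of S is counted once from each of them, with opposite signs. The
involution matching these two views cancels everything but the boundary. -/
theorem sum_gridBoundary (S : Finset (ℤ × ℤ)) (ψ : (ℤ × ℤ) × Fin 4 → ℂ)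
    (hψ : ∀ e, ψ (e.1 + gridDir e.2, e.2 + 2) = -ψ e) :
    ∑ e ∈ gridBoundary S, ψ e = ∑ q ∈ S, ∑ d, ψ (q, d) := by
  rw [← Finset.sum_product', gridBoundary,
    ← Finset.sum_filter_add_sum_filter_not (S ×ˢ Finset.univ) (fun e => e.1 + gridDir e.2 ∉ S)]
  rw [left_eq_add]
  refine Finset.sum_involution (fun e _ => (e.1 + gridDir e.2, e.2 + 2)) ?_ ?_ ?_ ?_
  · intro e _
    rw [hψ, add_neg_cancel]
  · intro e _ _ h
    have : e.2 + 2 = e.2 := congrArg Prod.snd h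
    revert this
    generalize e.2 = d
    revert d; decide
  · intro e he
    simp only [Finset.mem_filter, Finset.mem_product, Finset.mem_univ, and_true, not_not] at he ⊢
    refine ⟨he.2, ?_⟩
    rw [gridDir_add_two, add_neg_cancel_right]
    exact he.1
  · intro e _
    refine Prod.ext ?_ ?_
    · simp [gridDir_add_two]
    · have : ∀ d : Fin 4, d + 2 + 2 = d := by decide
      exact this e.2

/-! ### Cauchy's theorem and winding numbers for grid contours. -/

/-- The centre of a square of the grid. -/
noncomputable def gridCenter (δ : ℝ) (q : ℤ × ℤ) : ℂ := ⟨δ * (q.1 + 1 / 2), δ * (q.2 + 1 / 2)⟩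

/-- A closed square of the grid. -/
def gridSquare (δ : ℝ) (q : ℤ × ℤ) : Set ℂ :=
  {z | (δ * q.1 ≤ z.re ∧ z.re ≤ δ * (q.1 + 1)) ∧ (δ * q.2 ≤ z.im ∧ z.im ≤ δ * (q.2 + 1))}

/-- Half the diagonal is δ/√2, which is below 4δ/5. The factor stays below 1 so that the disc about
one centre contains no other centre. -/
theorem dist_gridCenter_lt {δ : ℝ} (hδ : 0 < δ) {q : ℤ × ℤ} {z : ℂ} (hz : z ∈ gridSquare δ q) :
    dist z (gridCenter δ q) < 4 / 5 * δ := by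
  obtain ⟨⟨h1, h2⟩, h3, h4⟩ := hz
  rw [Complex.dist_eq_re_im]
  refine (Real.sqrt_lt' (by positivity)).2 ?_
  simp only [gridCenter]
  nlinarith [mul_nonneg (sub_nonneg.2 h1) (sub_nonneg.2 h2),
    mul_nonneg (sub_nonneg.2 h3) (sub_nonneg.2 h4), mul_pos hδ hδ]

theorem gridSide_re (δ : ℝ) (e : (ℤ × ℤ) × Fin 4) (t : ℝ) : (gridSide δ e t).re =
    δ * (e.1.1 + (1 - t) * (gridOff e.2).1 + t * (gridOff (e.2 + 1)).1) := by
  simp [gridSide, gridPoint]; ring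

theorem gridSide_im (δ : ℝ) (e : (ℤ × ℤ) × Fin 4) (t : ℝ) : (gridSide δ e t).im =
    δ * (e.1.2 + (1 - t) * (gridOff e.2).2 + t * (gridOff (e.2 + 1)).2) := by
  simp [gridSide, gridPoint]; ring

theorem gridSide_mem {δ : ℝ} (hδ : 0 < δ) (e : (ℤ × ℤ) × Fin 4) {t : ℝ}
    (ht : t ∈ Set.Icc (0 : ℝ) 1) : gridSide δ e t ∈ gridSquare δ e.1 := by
  obtain ⟨h0, h1⟩ := ht
  simp only [gridSquare, Set.mem_ofPred_eq, gridSide_re, gridSide_im, mul_le_mul_iff_right₀ hδ,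
    add_assoc, add_le_add_iff_left, le_add_iff_nonneg_right]
  obtain ⟨q, d⟩ := e
  fin_cases d <;> simp [gridOff, h0, h1]

theorem gridSide_flip (δ : ℝ) (e : (ℤ × ℤ) × Fin 4) (t : ℝ) :
    gridSide δ (e.1 + gridDir e.2, e.2 + 2) (1 - t) = gridSide δ e t := by
  dsimp only [gridSide]
  rw [add_assoc e.1, add_assoc e.1, (gridOff_flip e.2).1, (gridOff_flip e.2).2]
  push_cast
  ring

theorem gridSide_mem_neighbour {δ : ℝ} (hδ : 0 < δ) (e : (ℤ × ℤ) × Fin 4) {t : ℝ}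
    (ht : t ∈ Set.Icc (0 : ℝ) 1) : gridSide δ e t ∈ gridSquare δ (e.1 + gridDir e.2) := by
  rw [← gridSide_flip]
  exact gridSide_mem hδ (e.1 + gridDir e.2, e.2 + 2) ⟨by linarith [ht.2], by linarith [ht.1]⟩

theorem gridSide_on_line (δ : ℝ) (e : (ℤ × ℤ) × Fin 4) (t : ℝ) :
    (∃ n : ℤ, (gridSide δ e t).re = δ * n) ∨ ∃ n : ℤ, (gridSide δ e t).im = δ * n := by
  obtain ⟨q, d⟩ := e
  simp only [gridSide_re, gridSide_im]
  fin_cases d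
  · exact Or.inr ⟨q.2, by simp [gridOff]⟩
  · exact Or.inl ⟨q.1 + 1, by simp [gridOff, add_assoc]⟩
  · exact Or.inr ⟨q.2 + 1, by simp [gridOff, add_assoc]⟩
  · exact Or.inl ⟨q.1, by simp [gridOff]⟩

/-- The disc contains the closed square and carries a primitive of F, whose increments telescope
around the four corners. -/
theorem sum_gridSideIntegral_eq_zero {δ : ℝ} (hδ : 0 < δ) (q : ℤ × ℤ) {F : ℂ → ℂ}
    (hF : DifferentiableOn ℂ F (Metric.ball (gridCenter δ q) (4 / 5 * δ))) :
    ∑ d, gridSideIntegral δ F (q, d) = 0 := by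
  obtain ⟨G, hG⟩ := hF.isExactOn_ball
  have key : ∀ d, gridSideIntegral δ F (q, d) =
      G (gridPoint δ (q + gridOff (d + 1))) - G (gridPoint δ (q + gridOff d)) := by
    intro d
    have hmem : ∀ t ∈ Set.uIcc (0 : ℝ) 1,
        gridSide δ (q, d) t ∈ Metric.ball (gridCenter δ q) (4 / 5 * δ) := fun t ht =>
      dist_gridCenter_lt hδ (gridSide_mem hδ (q, d) (by rwa [Set.uIcc_of_le zero_le_one] at ht))
    have hs : Continuous (gridSide δ (q, d)) :=
      continuous_iff_continuousAt.2 fun t => (hasDerivAt_gridSide δ (q, d) t).continuousAt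
    rw [← gridSide_one δ (q, d), ← gridSide_zero δ (q, d)]
    refine intervalIntegral.integral_eq_sub_of_hasDerivAt
      (f := fun t => G (gridSide δ (q, d) t)) (fun t ht => ?_) ?_
    · exact (hG _ (hmem t ht)).scomp t (hasDerivAt_gridSide δ (q, d) t)
    · refine ContinuousOn.intervalIntegrable (continuousOn_const.mul ?_)
      exact hF.continuousOn.comp hs.continuousOn hmem
  rw [Finset.sum_congr rfl fun d _ => key d, Finset.sum_sub_distrib,
    sub_eq_zero]
  exact Equiv.sum_comp (Equiv.addRight (1 : Fin 4)) fun d => G (gridPoint δ (q + gridOff d))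

/-- Seen from the centre, a side subtends a right angle. The primitive log(1 + (2t - 1)i) is used
because its argument has real part 1 and so avoids the branch cut. -/
theorem integral_side_centered :
    ∫ t in (0 : ℝ)..1, 2 / ((2 * (t : ℂ) - 1) - Complex.I) = Real.pi / 2 * Complex.I := by
  have hlog : Complex.log (1 + Complex.I) - Complex.log (1 - Complex.I) =
      Real.pi / 2 * Complex.I := by
    have harg : Complex.arg (1 + Complex.I) = Real.pi / 4 := by
      have h : (1 : ℂ) + Complex.I = ((√2 : ℝ) : ℂ) *
          (Complex.cos ((Real.pi / 4 : ℝ) : ℂ) + Complex.sin ((Real.pi / 4 : ℝ) : ℂ) * Complex.I) := by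
        rw [← Complex.ofReal_cos, ← Complex.ofReal_sin, Real.cos_pi_div_four, Real.sin_pi_div_four]
        have h2 : (√2 : ℝ) * (√2 / 2) = 1 := by
          rw [← mul_div_assoc, Real.mul_self_sqrt (by norm_num)]; norm_num
        have h3 : ((√2 : ℝ) : ℂ) * ((√2 / 2 : ℝ) : ℂ) = 1 := by exact_mod_cast h2
        linear_combination (-1 - Complex.I) * h3
      rw [h]
      exact Complex.arg_mul_cos_add_sin_mul_I (by positivity)
        ⟨by linarith [Real.pi_pos], by linarith [Real.pi_pos]⟩
    have hconj : (1 : ℂ) - Complex.I = (starRingEnd ℂ) (1 + Complex.I) := by simp [sub_eq_add_neg]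
    rw [hconj, Complex.log_conj _ (by rw [harg]; linarith [Real.pi_pos])]
    apply Complex.ext
    · simp
    · simp [Complex.log_im, harg]; ring
  have hs : ∀ t : ℝ, 1 + (2 * (t : ℂ) - 1) * Complex.I ∈ Complex.slitPlane := fun t =>
    Or.inl (by simp)
  have hne : ∀ t : ℝ, (2 * (t : ℂ) - 1) - Complex.I ≠ 0 := fun t h => by
    have := congrArg Complex.im h
    simp at this
  have h := intervalIntegral.integral_eq_sub_of_hasDerivAt (a := 0) (b := 1)
    (f := fun t : ℝ => Complex.log (1 + (2 * (t : ℂ) - 1) * Complex.I))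
    (f' := fun t : ℝ => 2 / ((2 * (t : ℂ) - 1) - Complex.I)) (fun t _ => ?_) ?_
  · rw [h, ← hlog]; norm_num; ring_nf
  · have hd : HasDerivAt (fun t : ℝ => 1 + (2 * (t : ℂ) - 1) * Complex.I) (2 * Complex.I) t := by
      have := ((((hasDerivAt_id t).ofReal_comp).const_mul (2 : ℂ)).sub_const 1).mul_const Complex.I
      simpa using this.const_add 1
    convert! hd.clog_real (hs t) using 1
    rw [div_eq_div_iff (hne t) (Complex.slitPlane_ne_zero (hs t))]
    linear_combination (2 : ℂ) * Complex.I_mul_I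
  · refine Continuous.intervalIntegrable ?_ _ _
    exact Continuous.div (by fun_prop) (by fun_prop) hne

/-- Rotation by a power of i about the centre carries one side to any other and leaves dz/(z -
centre) unchanged, so each side contributes a quarter of 2πi. -/
theorem sum_gridSideIntegral_center {δ : ℝ} (hδ : 0 < δ) (q : ℤ × ℤ) :
    ∑ d, gridSideIntegral δ (fun z => (z - gridCenter δ q)⁻¹) (q, d) =
      2 * Real.pi * Complex.I := by
  have hδ' : (δ : ℂ) ≠ 0 := by exact_mod_cast hδ.ne'
  have key : ∀ d, gridSideIntegral δ (fun z => (z - gridCenter δ q)⁻¹) (q, d) =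
      Real.pi / 2 * Complex.I := by
    intro d
    rw [← integral_side_centered]
    refine intervalIntegral.integral_congr fun t _ => ?_
    have h1 : gridPoint δ (q + gridOff (d + 1)) - gridPoint δ (q + gridOff d) =
        δ * Complex.I ^ (d : ℕ) := by
      fin_cases d <;> apply Complex.ext <;>
        simp [gridPoint, gridOff, pow_succ] <;> ring
    have h2 : gridSide δ (q, d) t - gridCenter δ q =
        δ / 2 * Complex.I ^ (d : ℕ) * ((2 * (t : ℂ) - 1) - Complex.I) := by
      rw [gridSide, h1]
      fin_cases d <;> apply Complex.ext <;>
        simp [gridPoint, gridOff, gridCenter, pow_succ] <;> ring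
    have hI : Complex.I ^ (d : ℕ) ≠ 0 := pow_ne_zero _ Complex.I_ne_zero
    dsimp only
    rw [h1, h2, mul_inv, mul_inv]
    field_simp
  rw [Finset.sum_congr rfl fun d _ => key d]
  simp
  ring

theorem le_dist_gridCenter {δ : ℝ} (hδ : 0 < δ) {q q' : ℤ × ℤ} (h : q ≠ q') :
    δ ≤ dist (gridCenter δ q) (gridCenter δ q') := by
  have key : ∀ m n : ℤ, m ≠ n → δ ≤ |δ * (m + 1 / 2) - δ * (n + 1 / 2)| := by
    intro m n hmn
    rw [show δ * ((m : ℝ) + 1 / 2) - δ * (n + 1 / 2) = δ * ((m - n : ℤ) : ℝ) by push_cast; ring,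
      abs_mul, abs_of_pos hδ]
    have h1 : (1 : ℝ) ≤ |((m - n : ℤ) : ℝ)| := by
      rw [← Int.cast_abs]
      exact_mod_cast Int.one_le_abs (sub_ne_zero.2 hmn)
    nlinarith
  rw [dist_eq_norm]
  by_cases h1 : q.1 = q'.1
  · have h2 : q.2 ≠ q'.2 := fun h2 => h (Prod.ext h1 h2)
    exact (key _ _ h2).trans (Complex.abs_im_le_norm (gridCenter δ q - gridCenter δ q'))
  · exact (key _ _ h1).trans (Complex.abs_re_le_norm (gridCenter δ q - gridCenter δ q'))

theorem gridContour_trace_subset {δ : ℝ} {S : Finset (ℤ × ℤ)} {z : ℂ}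
    (hz : z ∈ (gridContour δ S).trace) :
    ∃ e ∈ gridBoundary S, ∃ t ∈ Set.Icc (0 : ℝ) 1, z = gridSide δ e t := by
  obtain ⟨i, t, ht, rfl⟩ := hz
  exact ⟨_, ((gridBoundary S).equivFin.symm i).2, t, ht, rfl⟩

theorem gridContour_integral_eq_zero {δ : ℝ} (hδ : 0 < δ) {S : Finset (ℤ × ℤ)} {F : ℂ → ℂ}
    (hF : ∀ q ∈ S, DifferentiableOn ℂ F (Metric.ball (gridCenter δ q) (4 / 5 * δ))) :
    (gridContour δ S).integral F = 0 := by
  rw [gridContour_integral, sum_gridBoundary S _ (gridSideIntegral_flip δ F)]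
  exact Finset.sum_eq_zero fun q hq => sum_gridSideIntegral_eq_zero hδ q (hF q hq)

theorem gridContour_winding_center {δ : ℝ} (hδ : 0 < δ) {S : Finset (ℤ × ℤ)} {q : ℤ × ℤ}
    (hq : q ∈ S) : (gridContour δ S).winding (gridCenter δ q) = 2 * Real.pi * Complex.I := by
  rw [Contour.winding, gridContour_integral, sum_gridBoundary S _ (gridSideIntegral_flip δ _),
    Finset.sum_eq_single_of_mem q hq, sum_gridSideIntegral_center hδ q]
  intro q' _ hne
  refine sum_gridSideIntegral_eq_zero hδ q' fun z hz => ?_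
  refine (DifferentiableAt.inv (by fun_prop) fun h => ?_).differentiableWithinAt
  rw [sub_eq_zero.1 h, Metric.mem_ball] at hz
  linarith [le_dist_gridCenter hδ hne.symm]

/-- The segment from w to the centre lies in the open square, and hence off all grid lines, except
possibly at its starting point w, which is off the trace by assumption. -/
theorem gridContour_winding {δ : ℝ} (hδ : 0 < δ) {S : Finset (ℤ × ℤ)} {q : ℤ × ℤ}
    (hq : q ∈ S) {w : ℂ} (hw : w ∈ gridSquare δ q) (hwt : w ∉ (gridContour δ S).trace) :
    (gridContour δ S).winding w = 2 * Real.pi * Complex.I := by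
  rw [← gridContour_winding_center hδ hq]
  refine Contour.winding_eq_of_segment _ fun s hs hmem => ?_
  rcases hs.1.eq_or_lt with rfl | hs0
  · exact hwt (by simpa using hmem)
  obtain ⟨e, -, t, -, he⟩ := gridContour_trace_subset hmem
  obtain ⟨⟨h1, h2⟩, h3, h4⟩ := hw
  have hs1 := hs.2
  have key : ∀ (x : ℝ) (m n : ℤ), δ * m ≤ x → x ≤ δ * (m + 1) →
      x + s * (δ * (m + 1 / 2) - x) ≠ δ * n := by
    intro x m n ha hb heq
    have hl : δ * m < δ * n := by
      rw [← heq]; nlinarith [mul_pos hs0 hδ]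
    have hr : δ * n < δ * (m + 1) := by
      rw [← heq]; nlinarith [mul_pos hs0 hδ]
    have hl' : m < n := by exact_mod_cast lt_of_mul_lt_mul_left hl hδ.le
    have hr' : n < m + 1 := by exact_mod_cast lt_of_mul_lt_mul_left hr hδ.le
    omega
  rcases gridSide_on_line δ e t with ⟨n, hn⟩ | ⟨n, hn⟩
  · rw [← he] at hn
    refine key _ _ n h1 h2 (Eq.trans ?_ hn)
    simp [gridCenter]
  · rw [← he] at hn
    refine key _ _ n h3 h4 (Eq.trans ?_ hn)
    simp [gridCenter]

theorem exists_mem_gridSquare {δ : ℝ} (hδ : 0 < δ) (z : ℂ) : ∃ q, z ∈ gridSquare δ q := by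
  have key : ∀ x : ℝ, δ * ⌊x / δ⌋ ≤ x ∧ x ≤ δ * (⌊x / δ⌋ + 1) := fun x => by
    have h1 := Int.floor_le (x / δ)
    have h2 := (Int.lt_floor_add_one (x / δ)).le
    rw [le_div_iff₀ hδ] at h1
    rw [div_le_iff₀ hδ] at h2
    constructor <;> linarith
  exact ⟨(⌊z.re / δ⌋, ⌊z.im / δ⌋), key _, key _⟩

theorem finite_gridSquare_inter {δ : ℝ} (hδ : 0 < δ) {K : Set ℂ} (hK : IsCompact K) :
    {q | (gridSquare δ q ∩ K).Nonempty}.Finite := by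
  obtain ⟨r, hr, hb⟩ := hK.isBounded.exists_pos_norm_lt
  obtain ⟨N, hN⟩ := exists_nat_gt (r / δ + 1)
  refine ((Finset.Icc (-N : ℤ) N) ×ˢ (Finset.Icc (-N : ℤ) N)).finite_toSet.subset ?_
  rintro q ⟨z, ⟨⟨h1, h2⟩, h3, h4⟩, hz⟩
  have key : ∀ (x : ℝ) (m : ℤ), |x| < r → δ * m ≤ x → x ≤ δ * (m + 1) → -(N : ℤ) ≤ m ∧ m ≤ N := by
    intro x m hx ha hb
    have hN' : r + δ < N * δ := by
      have := (mul_lt_mul_iff_left₀ hδ).2 hN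
      rw [add_mul, div_mul_cancel₀ _ hδ.ne', one_mul] at this
      exact this
    obtain ⟨hx1, hx2⟩ := abs_lt.1 hx
    have e1 : δ * (-(N : ℝ)) < δ * (m : ℝ) := by nlinarith
    have e2 : δ * (m : ℝ) < δ * N := by nlinarith
    have e1' := lt_of_mul_lt_mul_left e1 hδ.le
    have e2' := lt_of_mul_lt_mul_left e2 hδ.le
    constructor
    · exact_mod_cast e1'.le
    · exact_mod_cast e2'.le
  simp only [Finset.coe_product, Finset.coe_Icc, Set.mem_prod, Set.mem_Icc]
  exact ⟨key _ _ ((Complex.abs_re_le_norm z).trans_lt (hb z hz)) h1 h2,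
    key _ _ ((Complex.abs_im_le_norm z).trans_lt (hb z hz)) h3 h4⟩

/-! ### A Cauchy contour around a compact set. -/

/-- A compact subset of an open set in the plane is surrounded by a contour in the open set for
which Cauchy's theorem and Cauchy's formula hold. -/
theorem exists_cauchy_contour {K Ω : Set ℂ} (hK : IsCompact K) (hΩ : IsOpen Ω) (hKΩ : K ⊆ Ω) :
    ∃ γ : Contour, γ.enclosesInfty = false ∧ γ.trace ⊆ Ω \ K ∧
      ∀ F : ℂ → ℂ, DifferentiableOn ℂ F Ω → γ.integral F = 0 ∧
        ∀ w ∈ K, γ.integral (fun z => (z - w)⁻¹ * F z) = 2 * Real.pi * Complex.I * F w := by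
  obtain ⟨ε, hε, hKε⟩ := hK.exists_thickening_subset_open hΩ hKΩ
  -- The disc of radius 4δ/5 about the centre of a square that meets K stays within 8δ/5 < 2δ = ε of
  -- K, hence in Ω.
  set δ := ε / 2 with hδdef
  have hδ : 0 < δ := by positivity
  set S := (finite_gridSquare_inter hδ hK).toFinset with hS
  have hmemS : ∀ q, q ∈ S ↔ (gridSquare δ q ∩ K).Nonempty := fun q => by simp [hS]
  have hball : ∀ q ∈ S, Metric.ball (gridCenter δ q) (4 / 5 * δ) ⊆ Ω := by
    intro q hq z hz
    obtain ⟨k, hk, hkK⟩ := (hmemS q).1 hq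
    refine hKε (Metric.mem_thickening_iff.2 ⟨k, hkK, ?_⟩)
    have h1 := dist_gridCenter_lt hδ hk
    rw [Metric.mem_ball] at hz
    have := dist_triangle_right z k (gridCenter δ q)
    linarith
  have htrace : (gridContour δ S).trace ⊆ Ω \ K := by
    intro z hz
    obtain ⟨e, he, t, ht, rfl⟩ := gridContour_trace_subset hz
    rw [mem_gridBoundary] at he
    -- A point of K on a boundary side would also lie in the neighbouring square and so put that
    -- square into S.
    refine ⟨hball _ he.1 (dist_gridCenter_lt hδ (gridSide_mem hδ e ht)), fun hk => he.2 ?_⟩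
    exact (hmemS _).2 ⟨_, gridSide_mem_neighbour hδ e ht, hk⟩
  have hzero : ∀ F : ℂ → ℂ, DifferentiableOn ℂ F Ω → (gridContour δ S).integral F = 0 :=
    fun F hF => gridContour_integral_eq_zero hδ fun q hq => hF.mono (hball q hq)
  refine ⟨gridContour δ S, rfl, htrace, fun F hF => ⟨hzero F hF, fun w hw => ?_⟩⟩
  have hwt : w ∉ (gridContour δ S).trace := fun h => (htrace h).2 hw
  obtain ⟨q, hq⟩ := exists_mem_gridSquare hδ w
  -- F(z)/(z - w) splits into the difference quotient of F at w, holomorphic on Ω and so of integral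
  -- zero, and F(w)/(z - w), which yields the winding number.
  have hdF : DifferentiableOn ℂ (dslope F w) Ω :=
    (Complex.differentiableOn_dslope (hΩ.mem_nhds (hKΩ hw))).2 hF
  have hcd : ContinuousOn (dslope F w) (gridContour δ S).trace :=
    hdF.continuousOn.mono fun z hz => (htrace hz).1
  have hci := Contour.continuousOn_inv_sub hwt
  rw [(gridContour δ S).integral_congr
    (G := fun z => dslope F w z + F w • (z - w)⁻¹), Contour.integral_add _ hcd
      (G := fun z => F w • (z - w)⁻¹) (hci.const_smul (F w)), Contour.integral_smul, hzero _ hdF, zero_add]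
  · change F w • (gridContour δ S).winding w = _
    rw [gridContour_winding hδ ((hmemS q).2 ⟨w, hq, hw⟩) hq hwt, smul_eq_mul, mul_comm]
  · intro z hz
    have hne : z ≠ w := fun h => hwt (h ▸ hz)
    dsimp only
    rw [dslope_of_ne _ hne, slope_def_module, smul_eq_mul, smul_eq_mul]
    ring

end TwoVarCalculus

namespace TwoVarCalculus
namespace Contour

/-! ### Cauchy's theorem -/

theorem continuousOn_winding_kernel {K L : Set ℂ} (h : Disjoint K L) :
    ContinuousOn (fun p : ℂ × ℂ => (p.2 - p.1)⁻¹) (K ×ˢ L) :=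
  ContinuousOn.inv₀ (by fun_prop) fun p hp e => h.le_bot ⟨hp.1, by
    rw [← sub_eq_zero.1 e]; exact hp.2⟩

theorem integral_inv_sub_right (Γ : Contour) (z : ℂ) :
    Γ.integral (fun w => (z - w)⁻¹) = -Γ.winding z := by
  have := Γ.integral_smul (-1) fun w => (w - z)⁻¹
  simp only [smul_eq_mul, neg_one_mul] at this
  rw [winding, ← this]
  exact Γ.integral_congr fun w _ => by simp only [← inv_neg, neg_sub]

/-- Let T be the open set of points off all traces at which the weighted winding number vanishes.
Its complement is compact, because winding numbers vanish far out, and lies in Ω. On the traces F is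
given by Cauchy's formula over a contour γ in Ω ∩ T. After exchanging the integrals, the integrand
over γ is F times minus the weighted winding number, which is zero there. -/
theorem sum_mul_integral_eq_zero {ι : Type*} [Fintype ι] (c : ι → ℂ) (Γ : ι → Contour)
    {Ω : Set ℂ} (hΩ : IsOpen Ω) (hΓ : ∀ k, (Γ k).trace ⊆ Ω)
    (hw : ∀ z ∉ Ω, ∑ k, c k * (Γ k).winding z = 0) {F : ℂ → ℂ} (hF : DifferentiableOn ℂ F Ω) :
    ∑ k, c k * (Γ k).integral F = 0 := by
  set T : Set ℂ := {z | (∀ k, z ∉ (Γ k).trace) ∧ ∑ k, c k * (Γ k).winding z = 0} with hT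
  have hTo : IsOpen T := by
    rw [isOpen_iff_mem_nhds]
    rintro z₀ ⟨h1, h2⟩
    filter_upwards [eventually_all.2 fun k => (Γ k).eventually_winding_eq (h1 k)] with z hz
    refine ⟨fun k => (hz k).1, ?_⟩
    rw [← h2]
    exact Finset.sum_congr rfl fun k _ => by rw [(hz k).2]
  have hTK : Tᶜ ⊆ Ω := by
    intro z hz
    by_contra hzΩ
    exact hz ⟨fun k hk => hzΩ (hΓ k hk), hw z hzΩ⟩
  have hTc : IsCompact Tᶜ := by
    refine Metric.isCompact_of_isClosed_isBounded hTo.isClosed_compl ?_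
    choose r _ hr using fun k => (Γ k).exists_norm_lt
    refine (Metric.isBounded_closedBall (x := (0 : ℂ)) (r := ∑ k, |r k|)).subset fun z hz => ?_
    rw [mem_closedBall_zero_iff]
    by_contra hlt
    have hlt' : ∀ k, ∀ w ∈ (Γ k).trace, ‖w‖ < ‖z‖ := fun k w hw =>
      (hr k w hw).trans_le (((le_abs_self _).trans (Finset.single_le_sum
        (f := fun k => |r k|) (fun _ _ => abs_nonneg _) (Finset.mem_univ k))).trans (not_le.1 hlt).le)
    refine hz ⟨fun k hk => lt_irrefl _ (hlt' k z hk), ?_⟩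
    exact Finset.sum_eq_zero fun k _ => by
      rw [(Γ k).winding_eq_zero_of_norm_lt (hlt' k), mul_zero]
  obtain ⟨γ, -, hγ, hC⟩ := exists_cauchy_contour hTc hΩ hTK
  have hγT : ∀ z ∈ γ.trace, z ∈ T := fun z hz => not_not.1 (hγ hz).2
  have hdis : ∀ k, Disjoint (Γ k).trace γ.trace := fun k =>
    Set.disjoint_left.2 fun z hz hz' => (hγT z hz').1 k hz
  have hFγ : ContinuousOn F γ.trace := hF.continuousOn.mono fun z hz => (hγ hz).1
  have hker : ∀ k, ContinuousOn (Function.uncurry fun w z => (z - w)⁻¹ * F z)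
      ((Γ k).trace ×ˢ γ.trace) := fun k =>
    (continuousOn_winding_kernel (hdis k)).mul
      (hFγ.comp continuous_snd.continuousOn fun p hp => hp.2)
  have h1 : ∀ k, 2 * Real.pi * Complex.I * (Γ k).integral F =
      γ.integral fun z => -(Γ k).winding z * F z := by
    intro k
    have e1 := (Γ k).integral_smul (2 * Real.pi * Complex.I) F
    simp only [smul_eq_mul] at e1
    rw [← e1, (Γ k).integral_congr (G := fun w => γ.integral fun z => (z - w)⁻¹ * F z),
      integral_integral_swap _ _ (hker k)]
    · refine γ.integral_congr fun z _ => ?_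
      have e2 := (Γ k).integral_smul (F z) fun w => (z - w)⁻¹
      simp only [smul_eq_mul] at e2
      rw [← integral_inv_sub_right, mul_comm, ← e2]
      exact (Γ k).integral_congr fun w _ => mul_comm _ _
    · exact fun w hw => ((hC F hF).2 w fun h => h.1 k hw).symm
  have h2 : ∀ k, ContinuousOn (fun z => c k * (-(Γ k).winding z * F z)) γ.trace := by
    intro k
    have hc : ContinuousOn (fun z => -(Γ k).winding z) γ.trace := by
      simp only [← integral_inv_sub_right]
      refine (Γ k).continuousOn_integral (F := fun z w => (z - w)⁻¹) ?_
      exact (continuousOn_winding_kernel (hdis k)).comp continuous_swap.continuousOn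
        fun p hp => ⟨hp.2, hp.1⟩
    exact continuousOn_const.mul (hc.mul hFγ)
  refine (mul_eq_zero.1 ?_).resolve_left Complex.two_pi_I_ne_zero
  rw [Finset.mul_sum]
  have h3 : ∀ k, 2 * Real.pi * Complex.I * (c k * (Γ k).integral F) =
      γ.integral fun z => c k * (-(Γ k).winding z * F z) := by
    intro k
    rw [mul_left_comm, h1]
    exact (γ.integral_smul (c k) _).symm
  rw [Finset.sum_congr rfl fun k _ => h3 k, ← γ.integral_sum _ fun k _ => h2 k,
    γ.integral_congr (G := fun _ => (0 : ℂ))]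
  · simp [integral]
  · intro z hz
    have := (hγT z hz).2
    dsimp only
    calc ∑ k, c k * (-(Γ k).winding z * F z) = -F z * ∑ k, c k * (Γ k).winding z := by
          rw [Finset.mul_sum]; exact Finset.sum_congr rfl fun k _ => by ring
      _ = 0 := by rw [this, mul_zero]

/-- Cauchy's theorem for finite linear combinations of contours that are homologous to zero. -/
theorem sum_smul_integral_eq_zero {E : Type*} [NormedAddCommGroup E] [NormedSpace ℂ E]
    [CompleteSpace E] {ι : Type*} [Fintype ι] (c : ι → ℂ) (Γ : ι → Contour)
    {Ω : Set ℂ} (hΩ : IsOpen Ω) (hΓ : ∀ k, (Γ k).trace ⊆ Ω)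
    (hw : ∀ z ∉ Ω, ∑ k, c k * (Γ k).winding z = 0) {F : ℂ → E} (hF : DifferentiableOn ℂ F Ω) :
    ∑ k, c k • (Γ k).integral F = 0 := by
  refine SeparatingDual.eq_zero_of_forall_dual_eq_zero (R := ℂ) fun L => ?_
  have h := sum_mul_integral_eq_zero c Γ hΩ hΓ hw
    (F := fun z => L (F z)) (L.differentiable.comp_differentiableOn hF)
  rw [map_sum, ← h]
  refine Finset.sum_congr rfl fun k _ => ?_
  rw [map_smul, ← (Γ k).integral_clm L (hF.continuousOn.mono (hΓ k)), smul_eq_mul]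

/-! ### Circles -/

/-- The circle of radius `r` about the origin. -/
noncomputable def circle (r : ℝ) : Contour where
  count := 1
  arc _ t := r * Complex.exp (2 * Real.pi * Complex.I * t)
  smooth _ := by
    have : ContDiff ℝ 1 (fun t : ℝ => (t : ℂ)) := Complex.ofRealCLM.contDiff
    have h : ContDiff ℝ 1 (fun t : ℝ => 2 * Real.pi * Complex.I * (t : ℂ)) := by fun_prop
    exact contDiff_const.mul h.cexp
  next := 1
  closed _ := by simp
  enclosesInfty := false

theorem norm_of_mem_trace_circle {r : ℝ} (hr : 0 ≤ r) {z : ℂ} (hz : z ∈ (circle r).trace) :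
    ‖z‖ = r := by
  obtain ⟨i, t, -, rfl⟩ := hz
  have : 2 * Real.pi * Complex.I * (t : ℂ) = ((2 * Real.pi * t : ℝ) : ℂ) * Complex.I := by
    push_cast; ring
  simp only [circle, this, norm_mul, Complex.norm_exp_ofReal_mul_I, mul_one, Complex.norm_real,
    Real.norm_eq_abs, abs_of_nonneg hr]

theorem deriv_arc_circle (r : ℝ) (i : Fin (circle r).count) (t : ℝ) :
    deriv ((circle r).arc i) t = 2 * Real.pi * Complex.I * (circle r).arc i t := by
  have h1 : HasDerivAt (fun t : ℝ => 2 * Real.pi * Complex.I * (t : ℂ))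
      (2 * Real.pi * Complex.I) t := by
    simpa using ((hasDerivAt_id t).ofReal_comp).const_mul (2 * Real.pi * Complex.I : ℂ)
  refine (h1.cexp.const_mul (r : ℂ)).deriv.trans ?_
  simp only [circle]
  ring

theorem arc_circle_ne_zero {r : ℝ} (hr : 0 < r) (i : Fin (circle r).count) (t : ℝ) :
    (circle r).arc i t ≠ 0 :=
  mul_ne_zero (by exact_mod_cast hr.ne') (Complex.exp_ne_zero _)

theorem integral_circle_inv {E : Type*} [NormedAddCommGroup E] [NormedSpace ℂ E] [CompleteSpace E]
    {r : ℝ} (hr : 0 < r) (v : E) :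
    (circle r).integral (fun z => z⁻¹ • v) = (2 * Real.pi * Complex.I) • v := by
  have : ∀ i t, deriv ((circle r).arc i) t • ((circle r).arc i t)⁻¹ • v =
      (2 * Real.pi * Complex.I) • v := by
    intro i t
    rw [deriv_arc_circle, smul_smul, mul_assoc, mul_inv_cancel₀ (arc_circle_ne_zero hr i t), mul_one]
  simp only [integral, this, intervalIntegral.integral_const, sub_zero, one_smul,
    Finset.sum_const, Finset.card_univ]
  exact one_smul ℕ _

theorem length_circle {r : ℝ} (hr : 0 < r) : (circle r).length = 2 * Real.pi * r := by
  have : ∀ i t, ‖deriv ((circle r).arc i) t‖ = 2 * Real.pi * r := by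
    intro i t
    have : 2 * Real.pi * Complex.I * (t : ℂ) = ((2 * Real.pi * t : ℝ) : ℂ) * Complex.I := by
      push_cast; ring
    rw [deriv_arc_circle]
    simp [circle, this, abs_of_pos hr, abs_of_pos Real.pi_pos, -Complex.ofReal_mul,
      Complex.norm_exp_ofReal_mul_I]
  simp only [length, this, intervalIntegral.integral_const, sub_zero, one_smul,
    Finset.sum_const, Finset.card_univ]
  exact one_smul ℕ _

theorem winding_circle {r : ℝ} {z : ℂ} (hz : ‖z‖ < r) :
    (circle r).winding z = 2 * Real.pi * Complex.I := by
  have hr : 0 < r := (norm_nonneg z).trans_lt hz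
  rw [winding_eq_of_norm_lt (z₀ := 0)]
  · have := integral_circle_inv hr (1 : ℂ)
    simpa [winding] using this
  · intro w hw
    simpa [norm_of_mem_trace_circle hr.le hw] using hz

/-- Compares F with v/z on the circle. It evaluates the contribution of ∞ when two contours disagree
about enclosing it. -/
theorem norm_integral_circle_sub_le {E : Type*} [NormedAddCommGroup E] [NormedSpace ℂ E]
    [CompleteSpace E] {r ε : ℝ} (hr : 0 < r) {F : ℂ → E} {v : E}
    (hF : ContinuousOn F (circle r).trace) (h : ∀ z, ‖z‖ = r → ‖z • F z - v‖ ≤ ε) :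
    ‖(circle r).integral F - (2 * Real.pi * Complex.I) • v‖ ≤ 2 * Real.pi * ε := by
  have hne : ∀ z ∈ (circle r).trace, z ≠ 0 := fun z hz => by
    rw [← norm_pos_iff, norm_of_mem_trace_circle hr.le hz]; exact hr
  rw [← integral_circle_inv hr v, ← integral_sub _ hF (G := fun z => z⁻¹ • v)
    ((continuousOn_id.inv₀ hne).smul continuousOn_const)]
  refine (norm_integral_le _ (ε := r⁻¹ * ε) fun z hz => ?_).trans_eq ?_
  · have h1 : F z - z⁻¹ • v = z⁻¹ • (z • F z - v) := by
      rw [smul_sub, smul_smul, inv_mul_cancel₀ (hne z hz), one_smul]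
    rw [h1, norm_smul, norm_inv, norm_of_mem_trace_circle hr.le hz]
    exact mul_le_mul_of_nonneg_left (h z (norm_of_mem_trace_circle hr.le hz)) (by positivity)
  · rw [length_circle hr]; field_simp

/-! ### Existence of envelopes -/

/-- The contour with the opposite orientation, regarded as enclosing `∞`. -/
noncomputable def reverse (Γ : Contour) : Contour where
  count := Γ.count
  arc i t := Γ.arc i (1 - t)
  smooth i := (Γ.smooth i).comp (contDiff_const.sub contDiff_id)
  next := Γ.next.symm
  closed i := by
    have := Γ.closed (Γ.next.symm i)
    rw [Equiv.apply_symm_apply] at this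
    simp [this]
  enclosesInfty := true

theorem trace_reverse (Γ : Contour) : Γ.reverse.trace ⊆ Γ.trace := by
  rintro z ⟨i, t, ht, rfl⟩
  exact ⟨i, 1 - t, ⟨by linarith [ht.2], by linarith [ht.1]⟩, rfl⟩

theorem winding_reverse (Γ : Contour) (z : ℂ) : Γ.reverse.winding z = -Γ.winding z := by
  simp only [winding, integral, ← Finset.sum_neg_distrib]
  refine Finset.sum_congr rfl fun (i : Fin Γ.count) _ => ?_
  have h := intervalIntegral.integral_comp_sub_left (a := 0) (b := 1)
    (fun t => deriv (Γ.arc i) t • (Γ.arc i t - z)⁻¹) 1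
  rw [sub_self, sub_zero] at h
  rw [← h, ← intervalIntegral.integral_neg]
  refine intervalIntegral.integral_congr fun t _ => ?_
  have hd : deriv (Γ.reverse.arc i) t = -deriv (Γ.arc i) (1 - t) :=
    deriv_comp_const_sub (f := Γ.arc i) 1 t
  change deriv (Γ.reverse.arc i) t • (Γ.reverse.arc i t - z)⁻¹ = _
  rw [hd, neg_smul]
  rfl

/-- Winding numbers on K come from Cauchy's formula for the constant 1; those off Ω from Cauchy's
theorem for 1/(z - w), which is holomorphic on Ω. -/
theorem exists_planar_envelope {K Ω : Set ℂ} (hK : IsCompact K) (hΩ : IsOpen Ω) (hKΩ : K ⊆ Ω) :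
    ∃ γ : Contour, γ.enclosesInfty = false ∧ γ.trace ⊆ Ω \ K ∧
      (∀ w ∈ K, γ.winding w = 2 * Real.pi * Complex.I) ∧ ∀ w ∉ Ω, γ.winding w = 0 := by
  obtain ⟨γ, h0, h1, h2⟩ := exists_cauchy_contour hK hΩ hKΩ
  refine ⟨γ, h0, h1, fun w hw => ?_, fun w hw => ?_⟩
  · have := (h2 (fun _ => 1) (differentiableOn_const _)).2 w hw
    simpa [winding] using this
  · refine (h2 (fun z => (z - w)⁻¹) fun z hz => ?_).1
    exact ((differentiableAt_id.sub_const w).inv fun h => hw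
      (by rwa [← sub_eq_zero.1 h])).differentiableWithinAt

/-- If ∞ ∉ σ, the finite part of σ is compact and a planar envelope works. If ∞ ∈ σ, it is the
complement of U that is compact in the plane: it is surrounded inside the complement of σ and the
orientation reversed, so that adding 1 turns the winding numbers -1 and 0 into 0 and 1. -/
theorem exists_isOrientedEnvelope {σ U : Set (OnePoint ℂ)} (hσ : IsClosed σ) (hU : IsOpen U)
    (hσU : σ ⊆ U) : ∃ Γ : Contour, Γ.IsOrientedEnvelope σ Uᶜ := by
  have key : ∀ s : Set (OnePoint ℂ), IsOpen s → OnePoint.infty ∈ s →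
      IsCompact ((fun z : ℂ => (z : OnePoint ℂ)) ⁻¹' s)ᶜ := fun s hs h =>
    ((OnePoint.isOpen_iff_of_mem h).1 hs).2
  have hop : ∀ s : Set (OnePoint ℂ), IsOpen s → IsOpen ((fun z : ℂ => (z : OnePoint ℂ)) ⁻¹' s) :=
    fun s hs => hs.preimage OnePoint.continuous_coe
  by_cases h : OnePoint.infty ∈ σ
  · obtain ⟨γ, -, h1, h2, h3⟩ := exists_planar_envelope (key U hU (hσU h)) (hop _ hσ.isOpen_compl)
      (fun z hz hz' => hz (hσU hz'))
    have hδ : γ.reverse.delta = 1 := rfl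
    refine ⟨γ.reverse, ?_, ?_, ?_⟩
    · rintro z hz (hz' | hz')
      · exact (h1 (γ.trace_reverse hz)).1 hz'
      · exact (h1 (γ.trace_reverse hz)).2 hz'
    · intro p hp
      induction p using OnePoint.rec with
      | infty => exact hδ
      | coe z =>
        rw [encloses_coe, winding_reverse, h3 z (fun hz => hz hp), hδ]
        simp
    · intro p hp
      induction p using OnePoint.rec with
      | infty => exact absurd (hσU h) hp
      | coe z =>
        rw [encloses_coe, winding_reverse, h2 z hp, hδ, mul_neg,
          inv_mul_cancel₀ Complex.two_pi_I_ne_zero]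
        simp
  · have hK := key σᶜ hσ.isOpen_compl h
    rw [Set.preimage_compl, compl_compl] at hK
    obtain ⟨γ, h0, h1, h2, h3⟩ := exists_planar_envelope hK (hop _ hU) (fun z hz => hσU hz)
    have hδ : γ.delta = 0 := by simp [delta, h0]
    refine ⟨γ, ?_, ?_, ?_⟩
    · rintro z hz (hz' | hz')
      · exact (h1 hz).2 hz'
      · exact hz' (h1 hz).1
    · intro p hp
      induction p using OnePoint.rec with
      | infty => exact absurd hp h
      | coe z =>
        rw [encloses_coe, h2 z hp, hδ, inv_mul_cancel₀ Complex.two_pi_I_ne_zero, zero_add]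
    · intro p hp
      induction p using OnePoint.rec with
      | infty => exact hδ
      | coe z => rw [encloses_coe, h3 z hp, hδ, mul_zero, add_zero]

end Contour
end TwoVarCalculus

namespace TwoVarCalculus
namespace MaximalPseudoResolvent

/-! ### Pseudo-resolvents in terms of their value at one base point. -/

variable {B : Type*} [NormedRing B] [NormedAlgebra ℂ B] {S : Subalgebra ℂ B}

/-- A pseudo-resolvent with empty domain is not maximal, since it extends by the value 0 at a single
point. -/
theorem regularSet_nonempty (R : MaximalPseudoResolvent S) : R.regularSet.Nonempty := by
  by_contra h
  rw [Set.not_nonempty_iff_eq_empty] at h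
  have := R.maximal {0} (fun _ => 0) (by simp [h]) (fun l _ m _ => by simp) (by simp [h])
  rw [h] at this
  exact Set.singleton_ne_empty _ this

/-- The operator whose invertibility decides whether `l` is a regular point. -/
noncomputable def shift (R : MaximalPseudoResolvent S) (m l : ℂ) : B :=
  1 + (l - m) • (R.toFun m : B)

theorem mul_shift (R : MaximalPseudoResolvent S) {m l : ℂ} (hm : m ∈ R.regularSet)
    (hl : l ∈ R.regularSet) : (R.toFun l : B) * R.shift m l = R.toFun m := by
  have h : (R.toFun l : B) - R.toFun m = -((l - m) • ((R.toFun l : B) * R.toFun m)) :=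
    congrArg Subtype.val (R.hilbert l hl m hm)
  rw [shift, mul_add, mul_one, mul_smul_comm, ← neg_eq_iff_eq_neg.2 h]
  abel

theorem shift_mul (R : MaximalPseudoResolvent S) {m l : ℂ} (hm : m ∈ R.regularSet)
    (hl : l ∈ R.regularSet) : R.shift m l * (R.toFun l : B) = R.toFun m := by
  have h : (R.toFun m : B) - R.toFun l = -((m - l) • ((R.toFun m : B) * R.toFun l)) :=
    congrArg Subtype.val (R.hilbert m hm l hl)
  rw [shift, add_mul, one_mul, smul_mul_assoc, ← neg_sub m l, neg_smul, ← h]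
  abel

/-- The Hilbert identity makes 1 - (l - m) R_l a two-sided inverse. -/
theorem isUnit_shift (R : MaximalPseudoResolvent S) {m l : ℂ} (hm : m ∈ R.regularSet)
    (hl : l ∈ R.regularSet) : IsUnit (R.shift m l) := by
  refine isUnit_iff_exists.2 ⟨1 - (l - m) • (R.toFun l : B), ?_, ?_⟩
  · rw [mul_sub, mul_one, mul_smul_comm, R.shift_mul hm hl, shift]; abel
  · rw [sub_mul, one_mul, smul_mul_assoc, R.mul_shift hm hl, shift]; abel

theorem toFun_eq (R : MaximalPseudoResolvent S) {m l : ℂ} (hm : m ∈ R.regularSet)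
    (hl : l ∈ R.regularSet) :
    (R.toFun l : B) = R.toFun m * Ring.inverse (R.shift m l) := by
  rw [← R.mul_shift hm hl, mul_assoc, Ring.mul_inverse_cancel _ (R.isUnit_shift hm hl), mul_one]

theorem shift_mem (R : MaximalPseudoResolvent S) (m l : ℂ) : R.shift m l ∈ S :=
  S.add_mem S.one_mem (S.smul_mem (R.toFun m).2 _)

/-- The formula R_m (1 + (x - m) R_m)⁻¹ defines a pseudo-resolvent at every x where the inverse
exists. Its values stay in S by fullness and it extends R, so maximality forbids any new x. -/
theorem mem_regularSet_iff (hS : IsFullSubalgebra S) (R : MaximalPseudoResolvent S) {m l : ℂ}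
    (hm : m ∈ R.regularSet) : l ∈ R.regularSet ↔ IsUnit (R.shift m l) := by
  refine ⟨R.isUnit_shift hm, fun hl => ?_⟩
  have hmem : ∀ x, IsUnit (R.shift m x) → Ring.inverse (R.shift m x) ∈ S := fun x hx =>
    hS _ (R.shift_mem m x) _ (Ring.mul_inverse_cancel _ hx) (Ring.inverse_mul_cancel _ hx)
  classical
  let R' : ℂ → S := fun x =>
    if hx : IsUnit (R.shift m x) then R.toFun m * ⟨Ring.inverse (R.shift m x), hmem x hx⟩ else 0
  have hR' : ∀ x, IsUnit (R.shift m x) →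
      (R' x : B) = R.toFun m * Ring.inverse (R.shift m x) := fun x hx => by
    simp [R', hx]
  have h := R.maximal {x | IsUnit (R.shift m x)} R' (fun x hx => R.isUnit_shift hm hx) ?_ ?_
  · rw [← h]; exact hl
  · intro x hx y hy
    apply Subtype.ext
    push_cast
    rw [hR' x hx, hR' y hy]
    have e1 : R.shift m y - R.shift m x = (y - x) • (R.toFun m : B) := by
      rw [shift, shift, add_sub_add_left_eq_sub, ← sub_smul]; congr 1; ring
    have e2 : Ring.inverse (R.shift m x) - Ring.inverse (R.shift m y) =
        (y - x) • (Ring.inverse (R.shift m x) * R.toFun m * Ring.inverse (R.shift m y)) := by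
      rw [← smul_mul_assoc, ← mul_smul_comm, ← e1, mul_sub, sub_mul,
        Ring.inverse_mul_cancel _ hx, mul_assoc, Ring.mul_inverse_cancel _ hy, mul_one, one_mul]
    rw [← mul_sub, e2, mul_smul_comm, ← neg_smul, neg_sub]
    simp only [mul_assoc]
  · intro x hx
    apply Subtype.ext
    rw [hR' x (R.isUnit_shift hm hx), ← R.toFun_eq hm hx]

/-! ### Joint dependence on the pseudo-resolvent and the parameter -/

theorem tendsto_shift {α : Type*} {F : Filter α} {Q : α → MaximalPseudoResolvent S}
    {R : MaximalPseudoResolvent S} {m l : ℂ} {x : α → ℂ}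
    (hQ : Tendsto (fun a => (Q a).toFun m) F (𝓝 (R.toFun m))) (hx : Tendsto x F (𝓝 l)) :
    Tendsto (fun a => (Q a).shift m (x a)) F (𝓝 (R.shift m l)) :=
  tendsto_const_nhds.add ((hx.sub_const m).smul ((continuous_subtype_val.tendsto _).comp hQ))

theorem coe_mem_extendedRegularSet (R : MaximalPseudoResolvent S) {l : ℂ} :
    (l : OnePoint ℂ) ∈ R.extendedRegularSet ↔ l ∈ R.regularSet := by
  simp [extendedRegularSet]

theorem mem_regularSet_of_notMem (R : MaximalPseudoResolvent S) {l : ℂ}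
    (h : (l : OnePoint ℂ) ∉ R.extendedSingularSet) : l ∈ R.regularSet :=
  R.coe_mem_extendedRegularSet.1 (not_not.1 h)

theorem infty_mem_extendedRegularSet (R : MaximalPseudoResolvent S) :
    OnePoint.infty ∈ R.extendedRegularSet ↔ (∀ᶠ l in Bornology.cobounded ℂ, l ∈ R.regularSet) ∧
      Tendsto (fun l : ℂ => l • R.toFun l) (Bornology.cobounded ℂ) (𝓝 1) := by
  simp [extendedRegularSet, OnePoint.infty_ne_coe]

theorem shift_eq_smul (R : MaximalPseudoResolvent S) {m l : ℂ} (h : l - m ≠ 0) :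
    R.shift m l = (l - m) • ((R.toFun m : B) + algebraMap ℂ B (l - m)⁻¹) := by
  rw [shift, smul_add, Algebra.algebraMap_eq_smul_one, smul_smul, mul_inv_cancel₀ h, one_smul,
    add_comm]

theorem isUnit_smul_iff' {c : ℂ} (hc : c ≠ 0) {b : B} : IsUnit (c • b) ↔ IsUnit b :=
  isUnit_smul_iff (Units.mk0 c hc) b

variable [CompleteSpace B]

theorem eventually_mem_regularSet (hS : IsFullSubalgebra S) {α : Type*} {F : Filter α}
    {Q : α → MaximalPseudoResolvent S} {R : MaximalPseudoResolvent S} {m l : ℂ} {x : α → ℂ}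
    (hm : m ∈ R.regularSet) (hmQ : ∀ᶠ a in F, m ∈ (Q a).regularSet)
    (hQ : Tendsto (fun a => (Q a).toFun m) F (𝓝 (R.toFun m)))
    (hl : l ∈ R.regularSet) (hx : Tendsto x F (𝓝 l)) :
    ∀ᶠ a in F, x a ∈ (Q a).regularSet := by
  have h := (tendsto_shift hQ hx).eventually
    (Units.isOpen.eventually_mem (R.isUnit_shift hm hl))
  filter_upwards [h, hmQ] with a ha hma
  exact ((Q a).mem_regularSet_iff hS hma).2 ha

/-- Inversion is continuous at units of the complete algebra B; the argument takes place there since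
S need not be complete. With α = ℕ × ℂ the index and the parameter can vary together. -/
theorem tendsto_toFun (hS : IsFullSubalgebra S) {α : Type*} {F : Filter α}
    {Q : α → MaximalPseudoResolvent S} {R : MaximalPseudoResolvent S} {m l : ℂ} {x : α → ℂ}
    (hm : m ∈ R.regularSet) (hmQ : ∀ᶠ a in F, m ∈ (Q a).regularSet)
    (hQ : Tendsto (fun a => (Q a).toFun m) F (𝓝 (R.toFun m)))
    (hl : l ∈ R.regularSet) (hx : Tendsto x F (𝓝 l)) :
    Tendsto (fun a => (Q a).toFun (x a)) F (𝓝 (R.toFun l)) := by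
  rw [tendsto_subtype_rng]
  obtain ⟨u, hu⟩ := R.isUnit_shift hm hl
  have h1 := tendsto_shift hQ hx
  have h2 := NormedRing.inverse_continuousAt u
  rw [hu] at h2
  rw [R.toFun_eq hm hl]
  refine (((continuous_subtype_val.tendsto _).comp hQ).mul (h2.tendsto.comp h1)).congr' ?_
  filter_upwards [hmQ, eventually_mem_regularSet hS hm hmQ hQ hl hx] with a ha ha'
  exact ((Q a).toFun_eq ha ha').symm

theorem isOpen_regularSet (hS : IsFullSubalgebra S) (R : MaximalPseudoResolvent S) :
    IsOpen R.regularSet := by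
  rw [isOpen_iff_eventually]
  intro l hl
  exact eventually_mem_regularSet hS (Q := fun _ => R) hl (Eventually.of_forall fun _ => hl)
    tendsto_const_nhds hl tendsto_id

theorem continuousAt_toFun (hS : IsFullSubalgebra S) (R : MaximalPseudoResolvent S) {l : ℂ}
    (hl : l ∈ R.regularSet) : ContinuousAt R.toFun l :=
  tendsto_toFun hS (Q := fun _ => R) hl (Eventually.of_forall fun _ => hl)
    tendsto_const_nhds hl tendsto_id

/-- By the Hilbert identity the difference quotient equals -R_x R_l. -/
theorem hasDerivAt_toFun (hS : IsFullSubalgebra S) (R : MaximalPseudoResolvent S) {l : ℂ}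
    (hl : l ∈ R.regularSet) : HasDerivAt R.toFun (-(R.toFun l * R.toFun l)) l := by
  rw [hasDerivAt_iff_tendsto_slope]
  have h : Tendsto (fun x => -(R.toFun x * R.toFun l)) (𝓝[≠] l) (𝓝 (-(R.toFun l * R.toFun l))) :=
    (((R.continuousAt_toFun hS hl).tendsto.mul_const _).neg).mono_left nhdsWithin_le_nhds
  refine h.congr' ?_
  filter_upwards [self_mem_nhdsWithin,
    nhdsWithin_le_nhds ((R.isOpen_regularSet hS).mem_nhds hl)] with x hx hxR
  rw [slope_def_module, R.hilbert x hxR l hl, smul_neg, smul_smul,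
    inv_mul_cancel₀ (sub_ne_zero.2 hx), one_smul]

/-! ### The point at infinity -/

/-- Dividing 1 + (x - m) Q_m by x - m leaves Q_m + (x - m)⁻¹, which tends to the invertible element
R_m. -/
theorem eventually_mem_regularSet_cobounded (hS : IsFullSubalgebra S) {α : Type*} {F : Filter α}
    {Q : α → MaximalPseudoResolvent S} {R : MaximalPseudoResolvent S} {m : ℂ} {x : α → ℂ}
    (hmQ : ∀ᶠ a in F, m ∈ (Q a).regularSet)
    (hQ : Tendsto (fun a => (Q a).toFun m) F (𝓝 (R.toFun m)))
    (hR : IsUnit (R.toFun m : B)) (hx : Tendsto x F (Bornology.cobounded ℂ)) :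
    ∀ᶠ a in F, x a ∈ (Q a).regularSet := by
  have hx' : Tendsto (fun a => (x a - m)) F (Bornology.cobounded ℂ) := by
    rw [← tendsto_norm_atTop_iff_cobounded] at hx ⊢
    refine tendsto_atTop_mono (fun a => norm_sub_norm_le (x a) m) ?_
    exact tendsto_atTop_add_const_right _ _ hx
  have h0 : Tendsto (fun a => ((Q a).toFun m : B) + algebraMap ℂ B (x a - m)⁻¹) F
      (𝓝 ((R.toFun m : B) + algebraMap ℂ B 0)) :=
    ((continuous_subtype_val.tendsto _).comp hQ).add
      (((continuous_algebraMap ℂ B).tendsto 0).comp (tendsto_inv₀_cobounded.comp hx'))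
  rw [map_zero, add_zero] at h0
  filter_upwards [h0.eventually (Units.isOpen.eventually_mem hR), hmQ,
    hx'.eventually (Bornology.eventually_ne_cobounded 0)] with a h1 h2 h3
  rw [(Q a).mem_regularSet_iff hS h2, shift_eq_smul _ h3, isUnit_smul_iff' h3]
  exact h1

/-- If λ R_λ → 1, some R_λ is invertible, and R_m is its product with an invertible shift.
Conversely, if R_m is invertible, then λ R_λ = λ/(λ - m) · R_m (R_m + (λ - m)⁻¹)⁻¹ tends to 1. -/
theorem infty_mem_iff_isUnit (hS : IsFullSubalgebra S) (R : MaximalPseudoResolvent S) {m : ℂ}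
    (hm : m ∈ R.regularSet) :
    OnePoint.infty ∈ R.extendedRegularSet ↔ IsUnit (R.toFun m : B) := by
  rw [infty_mem_extendedRegularSet]
  constructor
  · rintro ⟨h1, h2⟩
    have h3 : Tendsto (fun l : ℂ => l • (R.toFun l : B)) (Bornology.cobounded ℂ) (𝓝 1) :=
      (continuous_subtype_val.tendsto (1 : S)).comp h2
    obtain ⟨l, hl, hlu, hl0⟩ := (h1.and ((h3.eventually
      (Units.isOpen.eventually_mem isUnit_one)).and (Bornology.eventually_ne_cobounded 0))).exists
    rw [← R.mul_shift hm hl]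
    exact ((isUnit_smul_iff' hl0).1 hlu).mul (R.isUnit_shift hm hl)
  · intro h
    have h1 := eventually_mem_regularSet_cobounded hS (Q := fun _ : ℂ => R) (R := R) (x := fun l => l)
      (F := Bornology.cobounded ℂ)
      (Eventually.of_forall fun _ => hm) tendsto_const_nhds h tendsto_id
    refine ⟨h1, ?_⟩
    rw [tendsto_subtype_rng]
    obtain ⟨u, hu⟩ := h
    have hx' : Tendsto (fun l : ℂ => l - m) (Bornology.cobounded ℂ) (Bornology.cobounded ℂ) := by
      rw [← tendsto_norm_atTop_iff_cobounded]
      refine tendsto_atTop_mono (fun a => norm_sub_norm_le a m) ?_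
      exact tendsto_atTop_add_const_right _ _ tendsto_norm_cobounded_atTop
    have hi := tendsto_inv₀_cobounded.comp hx'
    have h0 : Tendsto (fun l : ℂ => (R.toFun m : B) + algebraMap ℂ B (l - m)⁻¹)
        (Bornology.cobounded ℂ) (𝓝 ((R.toFun m : B) + algebraMap ℂ B 0)) :=
      tendsto_const_nhds.add (((continuous_algebraMap ℂ B).tendsto 0).comp hi)
    rw [map_zero, add_zero] at h0
    have hinv := NormedRing.inverse_continuousAt u
    rw [hu] at hinv
    -- The scalar is l/(l - m), written so that its limit is visible.
    have h2 : Tendsto (fun l : ℂ => (1 + m * (l - m)⁻¹) • ((R.toFun m : B) *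
        Ring.inverse ((R.toFun m : B) + algebraMap ℂ B (l - m)⁻¹)))
        (Bornology.cobounded ℂ) (𝓝 ((1 + m * 0) • ((R.toFun m : B) * Ring.inverse (R.toFun m : B)))) :=
      (tendsto_const_nhds.add (tendsto_const_nhds.mul hi)).smul
        (tendsto_const_nhds.mul (hinv.tendsto.comp h0))
    have hone : (1 + m * 0) • ((R.toFun m : B) * Ring.inverse (R.toFun m : B)) = ((1 : S) : B) := by
      rw [mul_zero, add_zero, one_smul, Ring.mul_inverse_cancel _ ⟨u, hu⟩]; rfl
    rw [hone] at h2
    refine h2.congr' ?_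
    filter_upwards [h1, hx'.eventually (Bornology.eventually_ne_cobounded 0)] with l hl hl0
    have hus := R.isUnit_shift hm hl
    have hu' : IsUnit ((R.toFun m : B) + algebraMap ℂ B (l - m)⁻¹) := by
      rwa [shift_eq_smul _ hl0, isUnit_smul_iff' hl0] at hus
    have e : Ring.inverse (R.shift m l) =
        (l - m)⁻¹ • Ring.inverse ((R.toFun m : B) + algebraMap ℂ B (l - m)⁻¹) := by
      refine (hus.mul_right_inj).1 ?_
      rw [Ring.mul_inverse_cancel _ hus, shift_eq_smul _ hl0, smul_mul_smul_comm,
        mul_inv_cancel₀ hl0, one_smul, Ring.mul_inverse_cancel _ hu']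
    push_cast
    rw [R.toFun_eq hm hl, e, mul_smul_comm, smul_smul]
    congr 1
    field_simp
    ring

/-- Neighbourhoods of ∞ contain both large finite points and ∞ itself; invertibility of R_m, being
an open condition, handles each. -/
theorem eventually_mem_extendedRegularSet (hS : IsFullSubalgebra S) {ι : Type*} {F : Filter ι}
    {Q : ι → MaximalPseudoResolvent S} {R : MaximalPseudoResolvent S} {m : ℂ}
    (hm : m ∈ R.regularSet) (hmQ : ∀ᶠ a in F, m ∈ (Q a).regularSet)
    (hQ : Tendsto (fun a => (Q a).toFun m) F (𝓝 (R.toFun m)))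
    {p : OnePoint ℂ} (hp : p ∈ R.extendedRegularSet) :
    ∀ᶠ a in F ×ˢ 𝓝 p, a.2 ∈ (Q a.1).extendedRegularSet := by
  induction p using OnePoint.rec with
  | infty =>
    rw [R.infty_mem_iff_isUnit hS hm] at hp
    rw [OnePoint.nhds_infty_eq, Filter.prod_sup, eventually_sup, Filter.prod_map_right,
      Filter.prod_pure, eventually_map, eventually_map, coclosedCompact_eq_cocompact,
      ← Metric.cobounded_eq_cocompact]
    constructor
    · filter_upwards [eventually_mem_regularSet_cobounded hS (Q := fun a : ι × ℂ => Q a.1)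
        (tendsto_fst.eventually hmQ) (hQ.comp tendsto_fst) hp
        (tendsto_snd (f := F) (g := Bornology.cobounded ℂ))] with a ha
      exact (coe_mem_extendedRegularSet _).2 ha
    · filter_upwards [hmQ, ((continuous_subtype_val.tendsto _).comp hQ).eventually
        (Units.isOpen.eventually_mem hp)] with a h1 h2
      exact ((Q a).infty_mem_iff_isUnit hS h1).2 h2
  | coe l =>
    rw [coe_mem_extendedRegularSet] at hp
    rw [OnePoint.nhds_coe_eq, Filter.prod_map_right, eventually_map]
    filter_upwards [eventually_mem_regularSet hS (Q := fun a : ι × ℂ => Q a.1) hm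
      (tendsto_fst.eventually hmQ) (hQ.comp tendsto_fst) hp
      (tendsto_snd (f := F) (g := 𝓝 l))] with a ha
    exact (coe_mem_extendedRegularSet _).2 ha

/-! ### Closedness and upper semicontinuity of the extended singular set. -/

theorem isOpen_extendedRegularSet (hS : IsFullSubalgebra S) (R : MaximalPseudoResolvent S) :
    IsOpen R.extendedRegularSet := by
  rw [isOpen_iff_eventually]
  intro p hp
  obtain ⟨m, hm⟩ := R.regularSet_nonempty
  have h := eventually_mem_extendedRegularSet hS (F := pure ()) (Q := fun _ => R) hm
    (Eventually.of_forall fun _ => hm) tendsto_const_nhds hp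
  rw [Filter.pure_prod, eventually_map] at h
  exact h

theorem isClosed_extendedSingularSet (hS : IsFullSubalgebra S) (R : MaximalPseudoResolvent S) :
    IsClosed R.extendedSingularSet :=
  (R.isOpen_extendedRegularSet hS).isClosed_compl

theorem eventually_forall_mem_of_isCompact {α X : Type*} [TopologicalSpace X] {F : Filter α}
    {C : Set X} (hC : IsCompact C) {P : α → X → Prop}
    (h : ∀ p ∈ C, ∀ᶠ a in F ×ˢ 𝓝 p, P a.1 a.2) : ∀ᶠ a in F, ∀ p ∈ C, P a p := by
  have h1 : {a : α × X | P a.1 a.2} ∈ F ×ˢ 𝓝ˢ C := hC.mem_prod_nhdsSet_of_forall h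
  have h2 := Filter.prod_mono_right F principal_le_nhdsSet h1
  exact eventually_prod_principal_iff.1 h2

/-- The complement of V is compact and consists of extended regular points of the limit; local
regularity, uniform in the index, spreads over it by compactness. -/
theorem ConvergesTo.eventually_subset (hS : IsFullSubalgebra S)
    {Q : ℕ → MaximalPseudoResolvent S} {R : MaximalPseudoResolvent S} (h : ConvergesTo Q R)
    {V : Set (OnePoint ℂ)} (hV : IsOpen V) (hRV : R.extendedSingularSet ⊆ V) :
    ∀ᶠ n in atTop, (Q n).extendedSingularSet ⊆ V := by
  obtain ⟨m, hm, hmQ, hQ⟩ := h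
  have h1 : ∀ᶠ n in atTop, ∀ p ∈ Vᶜ, p ∈ (Q n).extendedRegularSet :=
    eventually_forall_mem_of_isCompact hV.isClosed_compl.isCompact fun p hp =>
      eventually_mem_extendedRegularSet hS hm hmQ hQ (not_not.1 fun h' => hp (hRV h'))
  filter_upwards [h1] with n hn p hp
  by_contra hpV
  exact hp (hn p hpV)

theorem ConvergesTo.tendsto_prod (hS : IsFullSubalgebra S)
    {Q : ℕ → MaximalPseudoResolvent S} {R : MaximalPseudoResolvent S} (h : ConvergesTo Q R)
    {l : ℂ} (hl : l ∈ R.regularSet) :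
    Tendsto (fun a : ℕ × ℂ => (Q a.1).toFun a.2) (atTop ×ˢ 𝓝 l) (𝓝 (R.toFun l)) := by
  obtain ⟨m, hm, hmQ, hQ⟩ := h
  exact tendsto_toFun hS (Q := fun a : ℕ × ℂ => Q a.1) hm (tendsto_fst.eventually hmQ)
    (hQ.comp tendsto_fst) hl tendsto_snd

end MaximalPseudoResolvent
end TwoVarCalculus

namespace TwoVarCalculus
namespace MaximalPseudoResolvent

variable {B : Type*} [NormedRing B] [NormedAlgebra ℂ B] [CompleteSpace B] {S : Subalgebra ℂ B}
variable {W : Type*} [NormedAddCommGroup W] [NormedSpace ℂ W]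

/-! ### The functional calculus of one variable -/

/-- The functional calculus of one variable, followed by the continuous linear map `L`:
`(2πi)⁻¹ ∫_Γ φ(λ) L(R_λ) dλ + δ φ(∞) L(1)`. -/
noncomputable def calculus (R : MaximalPseudoResolvent S) (L : S →L[ℂ] W) (φ : OnePoint ℂ → ℂ)
    (Γ : Contour) : W :=
  (2 * Real.pi * Complex.I : ℂ)⁻¹ • Γ.integral (fun l => φ l • L (R.toFun l)) +
    (Γ.delta * φ OnePoint.infty) • L 1

/-- `φ` is holomorphic at the finite points of `U` and continuous at `∞` if `∞ ∈ U`. -/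
structure SphereHolomorphicOn (φ : OnePoint ℂ → ℂ) (U : Set (OnePoint ℂ)) : Prop where
  differentiableAt : ∀ l : ℂ, (l : OnePoint ℂ) ∈ U → DifferentiableAt ℂ (fun l : ℂ => φ l) l
  tendsto_infty : OnePoint.infty ∈ U →
    Tendsto (fun l : ℂ => φ l) (Bornology.cobounded ℂ) (𝓝 (φ OnePoint.infty))

/-- Both envelopes surround z equally often. The factor 2πi is the winding integral of a large
circle, so Γ - Γ' plus a multiple of that circle is homologous to zero. -/
theorem winding_sub_winding {σ U : Set (OnePoint ℂ)} {Γ Γ' : Contour}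
    (hΓ : Γ.IsOrientedEnvelope σ Uᶜ) (hΓ' : Γ'.IsOrientedEnvelope σ Uᶜ) {z : ℂ}
    (hz : ¬((z : OnePoint ℂ) ∈ U ∧ (z : OnePoint ℂ) ∉ σ)) :
    Γ.winding z - Γ'.winding z + (Γ.delta - Γ'.delta) * (2 * Real.pi * Complex.I) = 0 := by
  have h : Γ.encloses (z : OnePoint ℂ) = Γ'.encloses (z : OnePoint ℂ) := by
    by_cases hU : (z : OnePoint ℂ) ∈ U
    · have hσ : (z : OnePoint ℂ) ∈ σ := by
        by_contra hσ
        exact hz ⟨hU, hσ⟩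
      rw [hΓ.encloses_one _ hσ, hΓ'.encloses_one _ hσ]
    · rw [hΓ.encloses_zero _ hU, hΓ'.encloses_zero _ hU]
  rw [Contour.encloses_coe, Contour.encloses_coe] at h
  have e : ∀ w : ℂ, 2 * Real.pi * Complex.I * ((2 * Real.pi * Complex.I)⁻¹ * w) = w := fun w =>
    mul_inv_cancel_left₀ Complex.two_pi_I_ne_zero w
  have h' := congrArg (fun w => 2 * Real.pi * Complex.I * w) h
  simp only [mul_add, e] at h'
  linear_combination h'

/-- If the contours agree about ∞, their difference is homologous to zero in U minus σ. Otherwise a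
large circle is added; as λ φ(λ) L(R_λ) → φ(∞) L(1), its integral tends to 2πi φ(∞) L(1), exactly
the discrepancy between the terms at ∞. -/
theorem calculus_eq_calculus [CompleteSpace W] (hS : IsFullSubalgebra S)
    (R : MaximalPseudoResolvent S)
    (L : S →L[ℂ] W) {φ : OnePoint ℂ → ℂ} {U : Set (OnePoint ℂ)} (hU : IsOpen U)
    (hφ : SphereHolomorphicOn φ U) {Γ Γ' : Contour}
    (hΓ : Γ.IsOrientedEnvelope R.extendedSingularSet Uᶜ)
    (hΓ' : Γ'.IsOrientedEnvelope R.extendedSingularSet Uᶜ) :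
    R.calculus L φ Γ = R.calculus L φ Γ' := by
  set σ := R.extendedSingularSet with hσ
  set Ω : Set ℂ := {z | (z : OnePoint ℂ) ∈ U ∧ (z : OnePoint ℂ) ∉ σ} with hΩdef
  have hO : IsOpen (U ∩ σᶜ) := hU.inter (R.isClosed_extendedSingularSet hS).isOpen_compl
  have hΩ : IsOpen Ω := hO.preimage OnePoint.continuous_coe
  set F : ℂ → W := fun l => φ l • L (R.toFun l) with hF
  have hFd : DifferentiableOn ℂ F Ω := fun z hz =>
    ((hφ.differentiableAt z hz.1).smul (L.differentiableAt.comp z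
      (R.hasDerivAt_toFun hS (R.mem_regularSet_of_notMem hz.2)).differentiableAt)).differentiableWithinAt
  have htr : ∀ {Γ : Contour}, Γ.IsOrientedEnvelope σ Uᶜ → Γ.trace ⊆ Ω := fun {Γ} h z hz =>
    ⟨not_not.1 fun h' => h.trace_avoids z hz (Or.inr h'), fun h' => h.trace_avoids z hz (Or.inl h')⟩
  have hw : ∀ z ∉ Ω, _ := fun z hz => winding_sub_winding hΓ hΓ' hz
  set v : W := φ OnePoint.infty • L 1 with hv
  have key : Γ.integral F - Γ'.integral F +
      ((Γ.delta - Γ'.delta) * (2 * Real.pi * Complex.I)) • v = 0 := by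
    by_cases hδ : Γ.delta = Γ'.delta
    · have h := Contour.sum_smul_integral_eq_zero ![1, -1] ![Γ, Γ'] hΩ ?_ ?_ hFd
      · simp only [Fin.sum_univ_two, Matrix.cons_val_zero, Matrix.cons_val_one, one_smul,
          neg_smul] at h
        rw [hδ, sub_self, zero_mul, zero_smul, add_zero, sub_eq_add_neg]
        exact h
      · intro k; fin_cases k
        · exact htr hΓ
        · exact htr hΓ'
      · intro z hz
        have := hw z hz
        rw [hδ, sub_self, zero_mul, add_zero] at this
        simpa [sub_eq_add_neg] using this
    -- On σ and off U both contours have a prescribed number of turns, so they can disagree at ∞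
    -- only if ∞ lies in U and not in σ.
    · have hi : OnePoint.infty ∈ U ∩ σᶜ := by
        refine ⟨by_contra fun h => hδ ?_, fun h => hδ ?_⟩
        · rw [← Contour.encloses_infty, ← Contour.encloses_infty, hΓ.encloses_zero _ h,
            hΓ'.encloses_zero _ h]
        · rw [← Contour.encloses_infty, ← Contour.encloses_infty, hΓ.encloses_one _ h,
            hΓ'.encloses_one _ h]
      have hΩi : ∀ᶠ z in Bornology.cobounded ℂ, z ∈ Ω := by
        rw [Metric.cobounded_eq_cocompact, ← coclosedCompact_eq_cocompact]
        exact OnePoint.tendsto_coe_infty.eventually (hO.eventually_mem hi)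
      have hlim : Tendsto (fun z : ℂ => z • F z) (Bornology.cobounded ℂ) (𝓝 v) := by
        have h1 := ((infty_mem_extendedRegularSet R).1 (not_not.1 hi.2)).2
        have h2 := (hφ.tendsto_infty hi.1).smul ((L.continuous.tendsto 1).comp h1)
        refine h2.congr fun z => ?_
        simp only [hF, Function.comp, map_smul]
        rw [smul_comm]
      refine norm_eq_zero.1 (le_antisymm (le_of_forall_pos_le_add fun ε hε => ?_) (norm_nonneg _))
      set ε' := ε / (‖Γ.delta - Γ'.delta‖ * (2 * Real.pi) + 1) with hε'
      have hden : 0 < ‖Γ.delta - Γ'.delta‖ * (2 * Real.pi) + 1 := by positivity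
      have hε'0 : 0 < ε' := div_pos hε hden
      have hnear : ∀ᶠ z in Bornology.cobounded ℂ, ‖z • F z - v‖ < ε' := by
        have := Metric.tendsto_nhds.1 hlim ε' hε'0
        simpa only [dist_eq_norm] using this
      obtain ⟨r₀, -, hr₀⟩ := (hasBasis_cobounded_norm (E := ℂ)).eventually_iff.1 (hΩi.and hnear)
      set r := max r₀ 1 with hr
      have hr1 : 0 < r := lt_of_lt_of_le one_pos (le_max_right _ _)
      have hcirc : (Contour.circle r).trace ⊆ Ω := fun z hz =>
        (hr₀ (by
          rw [Set.mem_ofPred_eq, Contour.norm_of_mem_trace_circle hr1.le hz]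
          exact le_max_left _ _)).1
      have h := Contour.sum_smul_integral_eq_zero ![1, -1, Γ.delta - Γ'.delta]
        ![Γ, Γ', Contour.circle r] hΩ ?_ ?_ hFd
      · simp only [Fin.sum_univ_three, Matrix.cons_val_zero, Matrix.cons_val_one, one_smul,
          Matrix.cons_val, neg_smul, ← sub_eq_add_neg] at h
        have hcl := Contour.norm_integral_circle_sub_le hr1 (ε := ε') (v := v)
          (hFd.continuousOn.mono hcirc)
          fun z hz => (hr₀ (by rw [Set.mem_ofPred_eq, hz]; exact le_max_left _ _)).2.le
        rw [eq_neg_of_add_eq_zero_left h, mul_smul, ← sub_eq_neg_add, ← smul_sub, norm_smul,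
          norm_sub_rev ((2 * Real.pi * Complex.I) • v), zero_add]
        calc ‖Γ.delta - Γ'.delta‖ * _ ≤ ‖Γ.delta - Γ'.delta‖ * (2 * Real.pi * ε') :=
              mul_le_mul_of_nonneg_left hcl (norm_nonneg _)
          _ ≤ (‖Γ.delta - Γ'.delta‖ * (2 * Real.pi) + 1) * ε' := by nlinarith
          _ = ε := mul_div_cancel₀ _ hden.ne'
      · intro k; fin_cases k
        · exact htr hΓ
        · exact htr hΓ'
        · exact hcirc
      · intro z hz
        -- Points of norm at least r belong to Ω, so only points inside the circle need checking.
        have hzr : ‖z‖ < r := by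
          by_contra hlt
          exact hz (hr₀ ((le_max_left _ _).trans (not_lt.1 hlt))).1
        have := hw z hz
        rw [← Contour.winding_circle hzr] at this
        simpa [Fin.sum_univ_three, sub_eq_add_neg] using this
  have h2 : (2 * Real.pi * Complex.I : ℂ)⁻¹ • (Γ.integral F - Γ'.integral F +
      ((Γ.delta - Γ'.delta) * (2 * Real.pi * Complex.I)) • v) = 0 := by rw [key, smul_zero]
  rw [smul_add, smul_sub, smul_smul, mul_comm (Γ.delta - Γ'.delta), inv_mul_cancel_left₀
    Complex.two_pi_I_ne_zero, sub_smul] at h2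
  simp only [calculus, mul_smul]
  rw [← sub_eq_zero, ← h2]
  abel

end MaximalPseudoResolvent
end TwoVarCalculus

namespace TwoVarCalculus

/-! ### The standard charts of the Riemann sphere -/

theorem localParam_coe (c t : ℂ) : localParam (c : OnePoint ℂ) t = ((c + t : ℂ) : OnePoint ℂ) := rfl

theorem localParam_infty (t : ℂ) : localParam OnePoint.infty t =
    if t = 0 then OnePoint.infty else ((t⁻¹ : ℂ) : OnePoint ℂ) := by
  classical
  change (if t = 0 then OnePoint.infty else ((t⁻¹ : ℂ) : OnePoint ℂ)) = _
  split_ifs <;> rfl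

theorem localParam_zero (p : OnePoint ℂ) : localParam p 0 = p := by
  induction p using OnePoint.rec with
  | infty => simp [localParam_infty]
  | coe c => simp [localParam_coe]

theorem tendsto_coe_cobounded :
    Tendsto (fun l : ℂ => (l : OnePoint ℂ)) (Bornology.cobounded ℂ) (𝓝 OnePoint.infty) := by
  rw [Metric.cobounded_eq_cocompact, ← coclosedCompact_eq_cocompact]
  exact OnePoint.tendsto_coe_infty

theorem continuousAt_localParam (p : OnePoint ℂ) : ContinuousAt (localParam p) 0 := by
  induction p using OnePoint.rec with
  | infty =>
    rw [continuousAt_iff_punctured_nhds, localParam_zero]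
    refine (tendsto_coe_cobounded.comp tendsto_inv₀_nhdsNE_zero).congr' ?_
    filter_upwards [self_mem_nhdsWithin] with t ht
    have ht' : t ≠ 0 := ht
    simp [localParam_infty, ht']
  | coe c =>
    have : localParam (c : OnePoint ℂ) = fun t => ((c + t : ℂ) : OnePoint ℂ) := rfl
    rw [this]
    exact (OnePoint.continuous_coe.comp (continuous_const.add continuous_id)).continuousAt

/-- The coordinate of a point of the sphere in the standard chart at `p`. -/
noncomputable def sphereChart : OnePoint ℂ → OnePoint ℂ → ℂ
  | _, none => 0
  | none, some l => l⁻¹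
  | some c, some l => l - c

/-- Inverts the local parameter near p, so that continuity in the parameters carries over to the
sphere. -/
theorem sphereChart_spec (p : OnePoint ℂ) :
    Tendsto (sphereChart p) (𝓝 p) (𝓝 0) ∧ ∀ᶠ x in 𝓝 p, localParam p (sphereChart p x) = x := by
  induction p using OnePoint.rec with
  | infty =>
    have h0 : sphereChart OnePoint.infty OnePoint.infty = 0 := rfl
    have h1 : ∀ l : ℂ, sphereChart OnePoint.infty (l : OnePoint ℂ) = l⁻¹ := fun l => rfl
    rw [OnePoint.nhds_infty_eq, coclosedCompact_eq_cocompact, ← Metric.cobounded_eq_cocompact,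
      tendsto_sup, eventually_sup, tendsto_map'_iff, eventually_map, eventually_pure, tendsto_pure_left]
    refine ⟨⟨tendsto_inv₀_cobounded.congr fun l => (h1 l).symm, fun s hs => ?_⟩, ?_, ?_⟩
    · rw [h0]; exact mem_of_mem_nhds hs
    · filter_upwards [Bornology.eventually_ne_cobounded 0] with l hl
      simp [h1, localParam_infty, hl]
    · simp [h0, localParam_infty]
  | coe c =>
    have h1 : ∀ l : ℂ, sphereChart (c : OnePoint ℂ) (l : OnePoint ℂ) = l - c := fun l => rfl
    rw [OnePoint.nhds_coe_eq, tendsto_map'_iff, eventually_map]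
    refine ⟨?_, Eventually.of_forall fun l => ?_⟩
    · have h : Tendsto (fun l : ℂ => l - c) (𝓝 c) (𝓝 (c - c)) := tendsto_id.sub_const c
      rw [sub_self] at h
      exact h.congr fun l => (h1 l).symm
    · rw [h1, localParam_coe, add_sub_cancel]

variable {g h : OnePoint ℂ × OnePoint ℂ → ℂ} {z : OnePoint ℂ × OnePoint ℂ}

theorem tendsto_localParam_prod (z : OnePoint ℂ × OnePoint ℂ) :
    Tendsto (fun t : ℂ × ℂ => (localParam z.1 t.1, localParam z.2 t.2)) (𝓝 0) (𝓝 z) := by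
  have h : ContinuousAt (fun t : ℂ × ℂ => (localParam z.1 t.1, localParam z.2 t.2)) 0 :=
    ((continuousAt_localParam z.1).comp_of_eq continuous_fst.continuousAt rfl).prodMk
      ((continuousAt_localParam z.2).comp_of_eq continuous_snd.continuousAt rfl)
  have h' := h.tendsto
  simp only [Prod.fst_zero, Prod.snd_zero, localParam_zero] at h'
  exact h'

theorem SphereAnalyticAt.congr (hg : SphereAnalyticAt g z) (hgh : g =ᶠ[𝓝 z] h) :
    SphereAnalyticAt h z :=
  AnalyticAt.congr hg (hgh.comp_tendsto (tendsto_localParam_prod z))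

theorem SphereAnalyticAt.continuousAt (hg : SphereAnalyticAt g z) : ContinuousAt g z := by
  obtain ⟨h1, h1'⟩ := sphereChart_spec z.1
  obtain ⟨h2, h2'⟩ := sphereChart_spec z.2
  have hc := AnalyticAt.continuousAt hg
  have ht : Tendsto (fun w : OnePoint ℂ × OnePoint ℂ => (sphereChart z.1 w.1, sphereChart z.2 w.2))
      (𝓝 z) (𝓝 (0 : ℂ × ℂ)) := by
    rw [nhds_prod_eq, Prod.zero_eq_mk, nhds_prod_eq]
    exact h1.prodMap h2
  have h := hc.tendsto.comp ht
  simp only [Prod.fst_zero, Prod.snd_zero, localParam_zero] at h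
  refine h.congr' ?_
  rw [nhds_prod_eq]
  filter_upwards [h1'.prod_mk h2'] with w hw
  simp only [Function.comp, hw.1, hw.2]

theorem SphereAnalyticAt.differentiableAt_left {l : ℂ} {p : OnePoint ℂ}
    (hg : SphereAnalyticAt g ((l : OnePoint ℂ), p)) :
    DifferentiableAt ℂ (fun x : ℂ => g ((x : OnePoint ℂ), p)) l := by
  have h1 : HasDerivAt (fun x : ℂ => ((x - l, 0) : ℂ × ℂ)) (1, 0) l :=
    ((hasDerivAt_id l).sub_const l).prodMk (hasDerivAt_const l 0)
  have h2 : DifferentiableAt ℂ (fun t : ℂ × ℂ => g (localParam (l : OnePoint ℂ) t.1,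
      localParam p t.2)) ((l - l, 0) : ℂ × ℂ) := by
    rw [sub_self]; exact AnalyticAt.differentiableAt hg
  have h3 := h2.comp l h1.differentiableAt
  refine h3.congr_of_eventuallyEq (Eventually.of_forall fun x => ?_)
  simp only [Function.comp, localParam_zero, localParam_coe, add_sub_cancel]

theorem SphereAnalyticAt.differentiableAt_right {l : ℂ} {p : OnePoint ℂ}
    (hg : SphereAnalyticAt g (p, (l : OnePoint ℂ))) :
    DifferentiableAt ℂ (fun x : ℂ => g (p, (x : OnePoint ℂ))) l := by
  have h1 : HasDerivAt (fun x : ℂ => ((0, x - l) : ℂ × ℂ)) (0, 1) l :=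
    (hasDerivAt_const l 0).prodMk ((hasDerivAt_id l).sub_const l)
  have h2 : DifferentiableAt ℂ (fun t : ℂ × ℂ => g (localParam p t.1,
      localParam (l : OnePoint ℂ) t.2)) ((0, l - l) : ℂ × ℂ) := by
    rw [sub_self]; exact AnalyticAt.differentiableAt hg
  have h3 := h2.comp l h1.differentiableAt
  refine h3.congr_of_eventuallyEq (Eventually.of_forall fun x => ?_)
  simp only [Function.comp, localParam_zero, localParam_coe, add_sub_cancel]

theorem sphereHolomorphicOn_left {U V : Set (OnePoint ℂ)}
    (hg : ∀ z ∈ U ×ˢ V, SphereAnalyticAt g z) {p : OnePoint ℂ} (hp : p ∈ V) :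
    MaximalPseudoResolvent.SphereHolomorphicOn (fun x => g (x, p)) U where
  differentiableAt l hl := (hg (l, p) ⟨hl, hp⟩).differentiableAt_left
  tendsto_infty h := (hg (OnePoint.infty, p) ⟨h, hp⟩).continuousAt.tendsto.comp
    ((tendsto_coe_cobounded).prodMk_nhds tendsto_const_nhds)

theorem sphereHolomorphicOn_right {U V : Set (OnePoint ℂ)}
    (hg : ∀ z ∈ U ×ˢ V, SphereAnalyticAt g z) {p : OnePoint ℂ} (hp : p ∈ U) :
    MaximalPseudoResolvent.SphereHolomorphicOn (fun x => g (p, x)) V where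
  differentiableAt l hl := (hg (p, l) ⟨hp, hl⟩).differentiableAt_right
  tendsto_infty h := (hg (p, OnePoint.infty) ⟨hp, h⟩).continuousAt.tendsto.comp
    (tendsto_const_nhds.prodMk_nhds (tendsto_coe_cobounded))

/-! ### The function `1 / (ν - f)` -/

variable {f : OnePoint ℂ × OnePoint ℂ → OnePoint ℂ} {U : Set (OnePoint ℂ × OnePoint ℂ)}

theorem recipSub_of_eq_coe {ν w : ℂ} (hw : f z = (w : OnePoint ℂ)) :
    recipSub f ν z = (ν - w)⁻¹ := by
  simp only [recipSub]; rw [hw]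

theorem recipSub_of_eq_infty {ν : ℂ} (hw : f z = OnePoint.infty) : recipSub f ν z = 0 := by
  simp only [recipSub]; rw [hw]

/-- At a pole, 1/(ν - f) = q/(νq - p), whose denominator equals -p ≠ 0 there; the formula also holds
on the polar set, where both sides vanish. Off the polar set f is locally analytic and ν - f is
nonzero at z. -/
theorem IsMeromorphicWithoutIndeterminacy.recipSub_spec
    (hf : IsMeromorphicWithoutIndeterminacy f U) {ν : ℂ} (hz : z ∈ U) (hfz : f z ≠ (ν : OnePoint ℂ)) :
    SphereAnalyticAt (recipSub f ν) z ∧ ∀ᶠ w in 𝓝 z, f w ≠ (ν : OnePoint ℂ) := by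
  obtain ⟨M, hM, hpole⟩ := hf
  by_cases hzM : z ∈ M
  · obtain ⟨⟨V, p, q, hV, hpz⟩, -⟩ := hpole z hzM
    have hp := hV.analytic_p z hV.mem
    have hq := hV.analytic_q z hV.mem
    have hqz : q z = 0 := (hV.zero_iff z hV.mem).2 hzM
    have hne : ν * q z - p z ≠ 0 := by simpa [hqz] using hpz
    have hev : ∀ᶠ w in 𝓝 z, ν * q w - p w ≠ 0 :=
      ((hq.continuousAt.const_mul ν).sub hp.continuousAt).eventually_ne hne
    have hVz := hV.isOpen.eventually_mem hV.mem
    constructor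
    · have han : SphereAnalyticAt (fun w => q w / (ν * q w - p w)) z := by
        refine AnalyticAt.div hq ((analyticAt_const.mul hq).sub hp) ?_
        simpa only [Prod.fst_zero, Prod.snd_zero, localParam_zero] using hne
      refine han.congr ?_
      filter_upwards [hev, hVz] with w hw hwV
      by_cases hwM : w ∈ M
      · rw [(hV.zero_iff w hwV).2 hwM, zero_div, recipSub_of_eq_infty (hpole w hwM).2]
      · have hqw : q w ≠ 0 := fun h => hwM ((hV.zero_iff w hwV).1 h)
        rw [recipSub_of_eq_coe (hV.eq_div w hwV hwM), ← inv_div]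
        congr 1
        field_simp
    · filter_upwards [hev, hVz] with w hw hwV
      by_cases hwM : w ∈ M
      · rw [(hpole w hwM).2]; exact OnePoint.infty_ne_coe ν
      · have hqw : q w ≠ 0 := fun h => hwM ((hV.zero_iff w hwV).1 h)
        rw [hV.eq_div w hwV hwM]
        intro h
        have h' := OnePoint.coe_injective h
        rw [div_eq_iff hqw] at h'
        exact hw (by rw [h', sub_self])
  · obtain ⟨g, hg, hfg⟩ := hM.analytic z hz hzM
    have hne : ν - g z ≠ 0 := fun h => hfz (by rw [hfg.self_of_nhds, sub_eq_zero.1 h])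
    constructor
    · have han : SphereAnalyticAt (fun w => (ν - g w)⁻¹) z := by
        refine AnalyticAt.inv (analyticAt_const.sub hg) ?_
        simpa only [Prod.fst_zero, Prod.snd_zero, localParam_zero] using hne
      refine han.congr ?_
      filter_upwards [hfg] with w hw
      rw [recipSub_of_eq_coe hw]
    · filter_upwards [hfg, (continuousAt_const.sub hg.continuousAt).eventually_ne hne] with w hw hw'
      rw [hw]
      intro h
      exact hw' (by rw [Pi.sub_apply, OnePoint.coe_injective h, sub_self])

theorem IsMeromorphicWithoutIndeterminacy.isOpen_ne (hf : IsMeromorphicWithoutIndeterminacy f U)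
    (hU : IsOpen U) (ν : ℂ) : IsOpen {z | z ∈ U ∧ f z ≠ (ν : OnePoint ℂ)} := by
  rw [isOpen_iff_eventually]
  rintro z ⟨hz, hfz⟩
  exact (hU.eventually_mem hz).and (hf.recipSub_spec hz hfz).2

end TwoVarCalculus

/-! ### Limits under contour integrals and stability of envelopes. -/

namespace TwoVarCalculus

/-- Convergence along the product filter at each point is locally uniform convergence, hence uniform
on the compact trace. -/
theorem Contour.tendsto_integral {E α : Type*} [NormedAddCommGroup E] [NormedSpace ℂ E]
    (Γ : Contour) {l : Filter α} {F : α → ℂ → E} {F₀ : ℂ → E}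
    (hF : ∀ᶠ a in l, ContinuousOn (F a) Γ.trace) (hF₀ : ContinuousOn F₀ Γ.trace)
    (h : ∀ z ∈ Γ.trace, Tendsto (fun a : α × ℂ => F a.1 a.2) (l ×ˢ 𝓝[Γ.trace] z) (𝓝 (F₀ z))) :
    Tendsto (fun a => Γ.integral (F a)) l (𝓝 (Γ.integral F₀)) := by
  have hu : TendstoUniformlyOn F F₀ l Γ.trace :=
    (tendstoLocallyUniformlyOn_iff_tendstoUniformlyOn_of_compact Γ.isCompact_trace).1 <| by
      rw [tendstoLocallyUniformlyOn_iff_forall_tendsto]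
      exact fun z hz => ((Tendsto.comp (hF₀ z hz) tendsto_snd).prodMk_nhds (h z hz)).mono_right
        (nhds_le_uniformity _)
  rw [Metric.tendsto_nhds]
  intro ε hε
  have hl : 0 < Γ.length + 1 := by linarith [Γ.length_nonneg]
  filter_upwards [hF, Metric.tendstoUniformlyOn_iff.1 hu (ε / (Γ.length + 1)) (by positivity)]
    with a ha hda
  rw [dist_eq_norm, ← Γ.integral_sub ha hF₀]
  refine (Γ.norm_integral_le (ε := ε / (Γ.length + 1)) fun z hz => ?_).trans_lt ?_
  · rw [← dist_eq_norm, dist_comm]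
    exact (hda z hz).le
  · rw [← mul_div_assoc, div_lt_iff₀ hl]
    nlinarith

namespace Contour.IsOrientedEnvelope

variable {Γ : Contour} {σ σ' U U' : Set (OnePoint ℂ)}

theorem mem_of_mem_trace (h : Γ.IsOrientedEnvelope σ Uᶜ) {z : ℂ} (hz : z ∈ Γ.trace) :
    (z : OnePoint ℂ) ∈ U :=
  not_not.1 fun h' => h.trace_avoids z hz (Or.inr h')

theorem infty_mem (h : Γ.IsOrientedEnvelope σ Uᶜ) (hδ : Γ.delta ≠ 0) : OnePoint.infty ∈ U :=
  not_not.1 fun h' => hδ (h.encloses_zero _ h')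

theorem mono (h : Γ.IsOrientedEnvelope σ Uᶜ) (hU : U ⊆ U') : Γ.IsOrientedEnvelope σ U'ᶜ where
  trace_avoids z hz hz' := h.trace_avoids z hz
    (hz'.imp_right fun hp => Set.compl_subset_compl.2 hU hp)
  encloses_one := h.encloses_one
  encloses_zero p hp := h.encloses_zero p (Set.compl_subset_compl.2 hU hp)

theorem of_subset (h : Γ.IsOrientedEnvelope σ Uᶜ)
    (hσ : σ' ⊆ {p : OnePoint ℂ | (∀ z ∈ Γ.trace, (z : OnePoint ℂ) ≠ p) ∧ Γ.encloses p = 1}) :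
    Γ.IsOrientedEnvelope σ' Uᶜ where
  trace_avoids z hz hz' := by
    rcases hz' with hz' | hz'
    · exact (hσ hz').1 z hz rfl
    · exact h.trace_avoids z hz (Or.inr hz')
  encloses_one p hp := (hσ hp).2
  encloses_zero := h.encloses_zero

theorem subset (h : Γ.IsOrientedEnvelope σ Uᶜ) :
    σ ⊆ {p : OnePoint ℂ | (∀ z ∈ Γ.trace, (z : OnePoint ℂ) ≠ p) ∧ Γ.encloses p = 1} :=
  fun p hp => ⟨fun z hz e => h.trace_avoids z hz (Or.inl (e ▸ hp)), h.encloses_one p hp⟩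

end Contour.IsOrientedEnvelope

namespace MaximalPseudoResolvent

/-- `h` is continuous on `U₁ × U₂` and holomorphic in each variable. -/
structure SeparatelyHolomorphicOn (h : OnePoint ℂ × OnePoint ℂ → ℂ) (U₁ U₂ : Set (OnePoint ℂ)) :
    Prop where
  isOpen_left : IsOpen U₁
  isOpen_right : IsOpen U₂
  continuousOn : ContinuousOn h (U₁ ×ˢ U₂)
  left : ∀ p ∈ U₂, SphereHolomorphicOn (fun x => h (x, p)) U₁
  right : ∀ p ∈ U₁, SphereHolomorphicOn (fun x => h (p, x)) U₂

theorem SeparatelyHolomorphicOn.swap {h : OnePoint ℂ × OnePoint ℂ → ℂ} {U₁ U₂ : Set (OnePoint ℂ)}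
    (H : SeparatelyHolomorphicOn h U₁ U₂) : SeparatelyHolomorphicOn (h ∘ Prod.swap) U₂ U₁ where
  isOpen_left := H.isOpen_right
  isOpen_right := H.isOpen_left
  continuousOn := H.continuousOn.comp continuous_swap.continuousOn fun _ hp => ⟨hp.2, hp.1⟩
  left := H.right
  right := H.left

theorem separatelyHolomorphicOn_of_analytic {h : OnePoint ℂ × OnePoint ℂ → ℂ}
    {U₁ U₂ : Set (OnePoint ℂ)} (hU₁ : IsOpen U₁) (hU₂ : IsOpen U₂)
    (hh : ∀ z ∈ U₁ ×ˢ U₂, SphereAnalyticAt h z) : SeparatelyHolomorphicOn h U₁ U₂ where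
  isOpen_left := hU₁
  isOpen_right := hU₂
  continuousOn z hz := (hh z hz).continuousAt.continuousWithinAt
  left _ hp := sphereHolomorphicOn_left hh hp
  right _ hp := sphereHolomorphicOn_right hh hp

variable {B₁ : Type*} [NormedRing B₁] [NormedAlgebra ℂ B₁] [CompleteSpace B₁] {S₁ : Subalgebra ℂ B₁}
variable {B₂ : Type*} [NormedRing B₂] [NormedAlgebra ℂ B₂] {S₂ : Subalgebra ℂ B₂}
variable {W : Type*} [NormedAddCommGroup W] [NormedSpace ℂ W]

theorem continuousOn_toFun_trace (hS₁ : IsFullSubalgebra S₁) {R : MaximalPseudoResolvent S₁}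
    {Γ : Contour} {τ : Set (OnePoint ℂ)} (hΓ : Γ.IsOrientedEnvelope R.extendedSingularSet τ) :
    ContinuousOn R.toFun Γ.trace := fun z hz =>
  (R.continuousAt_toFun hS₁ (R.mem_regularSet_of_notMem
    fun h => hΓ.trace_avoids z hz (Or.inl h))).continuousWithinAt

/-! ### The functional calculus of two variables -/

/-- The functional calculus of two variables for a continuous bilinear map `b`. -/
noncomputable def bicalculus (b : S₁ →L[ℂ] S₂ →L[ℂ] W) (R₁ : MaximalPseudoResolvent S₁)
    (R₂ : MaximalPseudoResolvent S₂) (h : OnePoint ℂ × OnePoint ℂ → ℂ) (Γ₁ Γ₂ : Contour) : W :=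
  ((2 * Real.pi * Complex.I : ℂ) ^ 2)⁻¹ •
      Γ₁.integral (fun l => Γ₂.integral (fun m =>
        h ((l : OnePoint ℂ), (m : OnePoint ℂ)) • b (R₁.toFun l) (R₂.toFun m))) +
    (Γ₂.delta * (2 * Real.pi * Complex.I : ℂ)⁻¹) •
      Γ₁.integral (fun l => h ((l : OnePoint ℂ), OnePoint.infty) • b (R₁.toFun l) 1) +
    (Γ₁.delta * (2 * Real.pi * Complex.I : ℂ)⁻¹) •
      Γ₂.integral (fun m => h (OnePoint.infty, (m : OnePoint ℂ)) • b 1 (R₂.toFun m)) +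
    (Γ₁.delta * Γ₂.delta * h (OnePoint.infty, OnePoint.infty)) • b 1 1

section

variable {b : S₁ →L[ℂ] S₂ →L[ℂ] W} {R₁ : MaximalPseudoResolvent S₁}
  {R₂ : MaximalPseudoResolvent S₂} {h : OnePoint ℂ × OnePoint ℂ → ℂ} {U₁ U₂ : Set (OnePoint ℂ)}
  {Γ₁ Γ₂ Γ₁' Γ₂' : Contour}

variable [CompleteSpace B₂] in
theorem continuousOn_kernel (hS₁ : IsFullSubalgebra S₁) (hS₂ : IsFullSubalgebra S₂)
    (H : SeparatelyHolomorphicOn h U₁ U₂)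
    (h₁ : Γ₁.IsOrientedEnvelope R₁.extendedSingularSet U₁ᶜ)
    (h₂ : Γ₂.IsOrientedEnvelope R₂.extendedSingularSet U₂ᶜ) :
    ContinuousOn (Function.uncurry fun l m : ℂ =>
      h ((l : OnePoint ℂ), (m : OnePoint ℂ)) • b (R₁.toFun l) (R₂.toFun m))
      (Γ₁.trace ×ˢ Γ₂.trace) := by
  have c1 : ContinuousOn (fun p : ℂ × ℂ => h ((p.1 : OnePoint ℂ), (p.2 : OnePoint ℂ)))
      (Γ₁.trace ×ˢ Γ₂.trace) :=
    H.continuousOn.comp (Continuous.prodMk (OnePoint.continuous_coe.comp continuous_fst)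
      (OnePoint.continuous_coe.comp continuous_snd)).continuousOn
      fun p hp => ⟨h₁.mem_of_mem_trace hp.1, h₂.mem_of_mem_trace hp.2⟩
  have c2 : ContinuousOn (fun p : ℂ × ℂ => (R₁.toFun p.1, R₂.toFun p.2))
      (Γ₁.trace ×ˢ Γ₂.trace) :=
    ((continuousOn_toFun_trace hS₁ h₁).comp continuous_fst.continuousOn fun p hp => hp.1).prodMk
      ((continuousOn_toFun_trace hS₂ h₂).comp continuous_snd.continuousOn fun p hp => hp.2)
  exact c1.smul (b.continuous₂.comp_continuousOn c2)

/-- The factor `delta` stays inside: h(·, ∞) is controlled only if ∞ ∈ U₂, which is guaranteed only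
when Γ₂ encloses ∞. -/
theorem continuousOn_slice (hS₁ : IsFullSubalgebra S₁) (H : SeparatelyHolomorphicOn h U₁ U₂)
    (h₁ : Γ₁.IsOrientedEnvelope R₁.extendedSingularSet U₁ᶜ)
    (h₂ : Γ₂.IsOrientedEnvelope R₂.extendedSingularSet U₂ᶜ) :
    ContinuousOn (fun l : ℂ => (Γ₂.delta * h ((l : OnePoint ℂ), OnePoint.infty)) •
      b (R₁.toFun l) 1) Γ₁.trace := by
  by_cases hδ : Γ₂.delta = 0
  · simp only [hδ, zero_mul, zero_smul]
    exact continuousOn_const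
  · have c1 : ContinuousOn (fun l : ℂ => h ((l : OnePoint ℂ), OnePoint.infty)) Γ₁.trace :=
      fun l hl => ((H.left _ (h₂.infty_mem hδ)).differentiableAt l
        (h₁.mem_of_mem_trace hl)).continuousAt.continuousWithinAt
    have c2 : Continuous fun a : S₁ => b a 1 := (b.flip 1).continuous
    exact (continuousOn_const.mul c1).smul
      (c2.comp_continuousOn (continuousOn_toFun_trace hS₁ h₁))

variable [CompleteSpace B₂]

theorem continuousOn_calculus (hS₁ : IsFullSubalgebra S₁) (hS₂ : IsFullSubalgebra S₂)
    (H : SeparatelyHolomorphicOn h U₁ U₂)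
    (h₁ : Γ₁.IsOrientedEnvelope R₁.extendedSingularSet U₁ᶜ)
    (h₂ : Γ₂.IsOrientedEnvelope R₂.extendedSingularSet U₂ᶜ) :
    ContinuousOn (fun l : ℂ => R₂.calculus (b (R₁.toFun l)) (fun p => h ((l : OnePoint ℂ), p)) Γ₂)
      Γ₁.trace :=
  ((Γ₂.continuousOn_integral (continuousOn_kernel hS₁ hS₂ H h₁ h₂)).const_smul _).add
    (continuousOn_slice hS₁ H h₁ h₂)

/-- Exhibits a one-variable calculus in R₂ for each frozen first argument, so that the one-variable
results apply. -/
theorem bicalculus_eq_iterated (hS₁ : IsFullSubalgebra S₁) (hS₂ : IsFullSubalgebra S₂)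
    (H : SeparatelyHolomorphicOn h U₁ U₂)
    (h₁ : Γ₁.IsOrientedEnvelope R₁.extendedSingularSet U₁ᶜ)
    (h₂ : Γ₂.IsOrientedEnvelope R₂.extendedSingularSet U₂ᶜ) :
    bicalculus b R₁ R₂ h Γ₁ Γ₂ = (2 * Real.pi * Complex.I : ℂ)⁻¹ • Γ₁.integral (fun l =>
        R₂.calculus (b (R₁.toFun l)) (fun p => h ((l : OnePoint ℂ), p)) Γ₂) +
      Γ₁.delta • R₂.calculus (b 1) (fun p => h (OnePoint.infty, p)) Γ₂ := by
  have c1 := (Γ₂.continuousOn_integral (continuousOn_kernel (b := b) hS₁ hS₂ H h₁ h₂)).const_smul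
    (2 * Real.pi * Complex.I : ℂ)⁻¹
  have c2 := continuousOn_slice (b := b) hS₁ H h₁ h₂
  have e := Γ₁.integral_add c1 c2
  simp only [Pi.smul_apply] at e
  have e1 := Γ₁.integral_smul (2 * Real.pi * Complex.I : ℂ)⁻¹ fun l => Γ₂.integral fun m =>
    h ((l : OnePoint ℂ), (m : OnePoint ℂ)) • b (R₁.toFun l) (R₂.toFun m)
  have e2 := Γ₁.integral_smul Γ₂.delta fun l =>
    h ((l : OnePoint ℂ), OnePoint.infty) • b (R₁.toFun l) 1
  simp only [smul_smul] at e2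
  simp only [calculus, bicalculus]
  rw [e, e2]
  erw [e1]
  simp only [smul_add, smul_smul, pow_two, mul_inv]
  simp only [mul_comm, mul_assoc, mul_left_comm, add_assoc]

theorem bicalculus_swap [CompleteSpace W] (hS₁ : IsFullSubalgebra S₁) (hS₂ : IsFullSubalgebra S₂)
    (H : SeparatelyHolomorphicOn h U₁ U₂)
    (h₁ : Γ₁.IsOrientedEnvelope R₁.extendedSingularSet U₁ᶜ)
    (h₂ : Γ₂.IsOrientedEnvelope R₂.extendedSingularSet U₂ᶜ) :
    bicalculus b R₁ R₂ h Γ₁ Γ₂ = bicalculus b.flip R₂ R₁ (h ∘ Prod.swap) Γ₂ Γ₁ := by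
  simp only [bicalculus, Function.comp, Prod.swap_prod_mk, ContinuousLinearMap.flip_apply]
  rw [Contour.integral_integral_swap _ _ (continuousOn_kernel hS₁ hS₂ H h₁ h₂),
    mul_comm Γ₂.delta Γ₁.delta]
  abel

theorem bicalculus_eq_right [CompleteSpace W] (hS₁ : IsFullSubalgebra S₁)
    (hS₂ : IsFullSubalgebra S₂) (H : SeparatelyHolomorphicOn h U₁ U₂)
    (h₁ : Γ₁.IsOrientedEnvelope R₁.extendedSingularSet U₁ᶜ)
    (h₂ : Γ₂.IsOrientedEnvelope R₂.extendedSingularSet U₂ᶜ)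
    (h₂' : Γ₂'.IsOrientedEnvelope R₂.extendedSingularSet U₂ᶜ) :
    bicalculus b R₁ R₂ h Γ₁ Γ₂ = bicalculus b R₁ R₂ h Γ₁ Γ₂' := by
  rw [bicalculus_eq_iterated hS₁ hS₂ H h₁ h₂, bicalculus_eq_iterated hS₁ hS₂ H h₁ h₂']
  congr 1
  · congr 1
    exact Γ₁.integral_congr fun l hl => calculus_eq_calculus hS₂ R₂ _ H.isOpen_right
      (H.right _ (h₁.mem_of_mem_trace hl)) h₂ h₂'
  · by_cases hδ : Γ₁.delta = 0
    · rw [hδ, zero_smul, zero_smul]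
    · rw [calculus_eq_calculus hS₂ R₂ _ H.isOpen_right (H.right _ (h₁.infty_mem hδ)) h₂ h₂']

/-- Γ₂ is changed directly; Γ₁ is changed after Fubini has exchanged the variables. -/
theorem bicalculus_eq_bicalculus [CompleteSpace W] (hS₁ : IsFullSubalgebra S₁)
    (hS₂ : IsFullSubalgebra S₂) (H : SeparatelyHolomorphicOn h U₁ U₂)
    (h₁ : Γ₁.IsOrientedEnvelope R₁.extendedSingularSet U₁ᶜ)
    (h₁' : Γ₁'.IsOrientedEnvelope R₁.extendedSingularSet U₁ᶜ)
    (h₂ : Γ₂.IsOrientedEnvelope R₂.extendedSingularSet U₂ᶜ)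
    (h₂' : Γ₂'.IsOrientedEnvelope R₂.extendedSingularSet U₂ᶜ) :
    bicalculus b R₁ R₂ h Γ₁ Γ₂ = bicalculus b R₁ R₂ h Γ₁' Γ₂' := by
  rw [bicalculus_eq_right hS₁ hS₂ H h₁ h₂ h₂', bicalculus_swap hS₁ hS₂ H h₁ h₂',
    bicalculus_eq_right hS₂ hS₁ H.swap h₂' h₁ h₁', ← bicalculus_swap hS₁ hS₂ H h₁' h₂']

end

/-! ### Convergence -/

variable [CompleteSpace B₂]

/-- The map L, the function φ and the pseudo-resolvent all vary along an arbitrary filter, because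
in two variables L and φ depend on the outer integration point. -/
theorem tendsto_calculus {α : Type*} {F : Filter α} (hS₁ : IsFullSubalgebra S₁)
    {Q : α → MaximalPseudoResolvent S₁} {R : MaximalPseudoResolvent S₁} {L : α → S₁ →L[ℂ] W}
    {L₀ : S₁ →L[ℂ] W} {φ : α → OnePoint ℂ → ℂ} {φ₀ : OnePoint ℂ → ℂ} {U : Set (OnePoint ℂ)}
    {Γ : Contour}
    (hΓ : Γ.IsOrientedEnvelope R.extendedSingularSet Uᶜ)
    (hΓQ : ∀ᶠ a in F, Γ.IsOrientedEnvelope (Q a).extendedSingularSet Uᶜ)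
    (hQ : ∀ z ∈ Γ.trace, Tendsto (fun a : α × ℂ => (Q a.1).toFun a.2) (F ×ˢ 𝓝 z) (𝓝 (R.toFun z)))
    (hL : Tendsto L F (𝓝 L₀)) (hφa : ∀ᶠ a in F, SphereHolomorphicOn (φ a) U)
    (hφ₀ : SphereHolomorphicOn φ₀ U)
    (hφ : ∀ z ∈ Γ.trace, Tendsto (fun a : α × ℂ => φ a.1 a.2) (F ×ˢ 𝓝 z) (𝓝 (φ₀ z)))
    (hφi : OnePoint.infty ∈ U → Tendsto (fun a => φ a OnePoint.infty) F (𝓝 (φ₀ OnePoint.infty))) :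
    Tendsto (fun a => (Q a).calculus (L a) (φ a) Γ) F (𝓝 (R.calculus L₀ φ₀ Γ)) := by
  have hcont : ∀ {Q : MaximalPseudoResolvent S₁} {L : S₁ →L[ℂ] W} {φ : OnePoint ℂ → ℂ},
      Γ.IsOrientedEnvelope Q.extendedSingularSet Uᶜ → SphereHolomorphicOn φ U →
      ContinuousOn (fun l : ℂ => φ l • L (Q.toFun l)) Γ.trace := fun {Q L φ} h hφ =>
    ContinuousOn.smul (fun z hz => (hφ.differentiableAt z
      (h.mem_of_mem_trace hz)).continuousAt.continuousWithinAt)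
      (L.continuous.comp_continuousOn (continuousOn_toFun_trace hS₁ h))
  have happ : Continuous fun p : (S₁ →L[ℂ] W) × S₁ => p.1 p.2 :=
    isBoundedBilinearMap_apply.continuous
  refine Tendsto.add (Tendsto.const_smul (Γ.tendsto_integral ?_ (hcont hΓ hφ₀) fun z hz => ?_) _) ?_
  · filter_upwards [hΓQ, hφa] with a h1 h2 using hcont h1 h2
  · refine Tendsto.mono_left ?_ (Filter.prod_mono_right F (nhdsWithin_le_nhds (s := Γ.trace)))
    exact (hφ z hz).smul ((happ.tendsto (L₀, R.toFun z)).comp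
      ((hL.comp tendsto_fst).prodMk_nhds (hQ z hz)))
  · by_cases hδ : Γ.delta = 0
    · simp only [hδ, zero_mul, zero_smul]
      exact tendsto_const_nhds
    · exact (tendsto_const_nhds.mul (hφi (hΓ.infty_mem hδ))).smul
        ((happ.tendsto (L₀, 1)).comp (hL.prodMk_nhds tendsto_const_nhds))

/-- The inner calculus converges jointly in n and the point of Γ₁, which is what passing to the
limit under the outer integral requires. -/
theorem tendsto_bicalculus (hS₁ : IsFullSubalgebra S₁) (hS₂ : IsFullSubalgebra S₂)
    (b : S₁ →L[ℂ] S₂ →L[ℂ] W) {Q₁ : ℕ → MaximalPseudoResolvent S₁}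
    {Q₂ : ℕ → MaximalPseudoResolvent S₂} {R₁ : MaximalPseudoResolvent S₁}
    {R₂ : MaximalPseudoResolvent S₂} {h : OnePoint ℂ × OnePoint ℂ → ℂ} {U₁ U₂ : Set (OnePoint ℂ)}
    {Γ₁ Γ₂ : Contour} (H : SeparatelyHolomorphicOn h U₁ U₂)
    (hQ₁ : ConvergesTo Q₁ R₁) (hQ₂ : ConvergesTo Q₂ R₂)
    (h₁ : Γ₁.IsOrientedEnvelope R₁.extendedSingularSet U₁ᶜ)
    (h₂ : Γ₂.IsOrientedEnvelope R₂.extendedSingularSet U₂ᶜ)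
    (h₁' : ∀ᶠ n in atTop, Γ₁.IsOrientedEnvelope (Q₁ n).extendedSingularSet U₁ᶜ)
    (h₂' : ∀ᶠ n in atTop, Γ₂.IsOrientedEnvelope (Q₂ n).extendedSingularSet U₂ᶜ) :
    Tendsto (fun n => bicalculus b (Q₁ n) (Q₂ n) h Γ₁ Γ₂) atTop
      (𝓝 (bicalculus b R₁ R₂ h Γ₁ Γ₂)) := by
  have hreg : ∀ z ∈ Γ₁.trace, z ∈ R₁.regularSet := fun z hz =>
    R₁.mem_regularSet_of_notMem fun h => h₁.trace_avoids z hz (Or.inl h)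
  have hreg₂ : ∀ z ∈ Γ₂.trace, z ∈ R₂.regularSet := fun z hz =>
    R₂.mem_regularSet_of_notMem fun h => h₂.trace_avoids z hz (Or.inl h)
  have hat : ∀ p ∈ U₁ ×ˢ U₂, ContinuousAt h p := fun p hp =>
    H.continuousOn.continuousAt ((H.isOpen_left.prod H.isOpen_right).mem_nhds hp)
  rw [bicalculus_eq_iterated hS₁ hS₂ H h₁ h₂]
  have hev : ∀ᶠ n in atTop, (2 * Real.pi * Complex.I : ℂ)⁻¹ • Γ₁.integral (fun l =>
        (Q₂ n).calculus (b ((Q₁ n).toFun l)) (fun p => h ((l : OnePoint ℂ), p)) Γ₂) +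
      Γ₁.delta • (Q₂ n).calculus (b 1) (fun p => h (OnePoint.infty, p)) Γ₂ =
      bicalculus b (Q₁ n) (Q₂ n) h Γ₁ Γ₂ := by
    filter_upwards [h₁', h₂'] with n e1 e2
    exact (bicalculus_eq_iterated hS₁ hS₂ H e1 e2).symm
  refine Tendsto.congr' hev (Tendsto.add (Tendsto.const_smul (Γ₁.tendsto_integral ?_
    (continuousOn_calculus hS₁ hS₂ H h₁ h₂) fun l hl => ?_) _) ?_)
  · filter_upwards [h₁', h₂'] with n e1 e2
    exact continuousOn_calculus hS₁ hS₂ H e1 e2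
  · have hlU := h₁.mem_of_mem_trace hl
    have hc : Tendsto (fun a : ℕ × ℂ => (a.2 : OnePoint ℂ)) (atTop ×ˢ 𝓝[Γ₁.trace] l)
        (𝓝 (l : OnePoint ℂ)) :=
      ((OnePoint.continuous_coe.tendsto l).mono_left nhdsWithin_le_nhds).comp tendsto_snd
    refine tendsto_calculus hS₂ (Q := fun a : ℕ × ℂ => Q₂ a.1)
      (φ := fun (a : ℕ × ℂ) p => h ((a.2 : OnePoint ℂ), p)) h₂
      (tendsto_fst.eventually h₂') (fun z hz => ?_) ?_ ?_ (H.right _ hlU) (fun z hz => ?_)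
      fun hi => (hat (l, OnePoint.infty) ⟨hlU, hi⟩).tendsto.comp (hc.prodMk_nhds tendsto_const_nhds)
    · exact (hQ₂.tendsto_prod hS₂ (hreg₂ z hz)).comp
        ((tendsto_fst.comp tendsto_fst).prodMk tendsto_snd)
    · refine (b.continuous.tendsto _).comp ((hQ₁.tendsto_prod hS₁ (hreg l hl)).mono_left ?_)
      exact Filter.prod_mono_right _ nhdsWithin_le_nhds
    · filter_upwards [tendsto_snd.eventually self_mem_nhdsWithin] with a ha
      exact H.right _ (h₁.mem_of_mem_trace ha)
    · exact (hat (l, z) ⟨hlU, h₂.mem_of_mem_trace hz⟩).tendsto.comp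
        ((hc.comp tendsto_fst).prodMk_nhds ((OnePoint.continuous_coe.tendsto z).comp tendsto_snd))
  · by_cases hδ : Γ₁.delta = 0
    · simp only [hδ, zero_smul]
      exact tendsto_const_nhds
    · have hi := h₁.infty_mem hδ
      refine Tendsto.const_smul (tendsto_calculus hS₂ h₂ h₂' (fun z hz =>
        hQ₂.tendsto_prod hS₂ (hreg₂ z hz)) tendsto_const_nhds
        (Eventually.of_forall fun _ => H.right _ hi) (H.right _ hi) (fun z hz => ?_)
        fun _ => tendsto_const_nhds) _
      exact ((H.right _ hi).differentiableAt z
        (h₂.mem_of_mem_trace hz)).continuousAt.tendsto.comp tendsto_snd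

end MaximalPseudoResolvent

/-! ### The resolvent of a function -/

namespace ExtendedTensorProduct

variable {X Y Z : Type*}
  [NormedAddCommGroup X] [NormedSpace ℂ X] [CompleteSpace X]
  [NormedAddCommGroup Y] [NormedSpace ℂ Y] [CompleteSpace Y]
  [NormedAddCommGroup Z] [NormedSpace ℂ Z] [CompleteSpace Z]

/-- The continuous bilinear map `(A, B) ↦ A ⊠ B`. -/
noncomputable def bilinear (E : ExtendedTensorProduct X Y Z) :
    E.BX →L[ℂ] E.BY →L[ℂ] (Z →L[ℂ] Z) :=
  LinearMap.mkContinuous₂ ((TensorProduct.mk ℂ E.BX E.BY).compr₂ E.K.toLinearMap) 1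
    fun A B => by
      rw [one_mul]
      exact (E.norm_K A B).le

theorem calculus_eq_bicalculus (E : ExtendedTensorProduct X Y Z)
    (R₁ : MaximalPseudoResolvent E.BX) (R₂ : MaximalPseudoResolvent E.BY)
    (h : OnePoint ℂ × OnePoint ℂ → ℂ) (Γ₁ Γ₂ : Contour) :
    E.calculus R₁ R₂ h Γ₁ Γ₂ = MaximalPseudoResolvent.bicalculus E.bilinear R₁ R₂ h Γ₁ Γ₂ := rfl

variable {E : ExtendedTensorProduct X Y Z} {f : OnePoint ℂ × OnePoint ℂ → OnePoint ℂ}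
  {U : Set (OnePoint ℂ × OnePoint ℂ)} {R₁ : MaximalPseudoResolvent E.BX}
  {R₂ : MaximalPseudoResolvent E.BY} {ν : ℂ}

theorem separatelyHolomorphicOn_recipSub (hf : IsMeromorphicWithoutIndeterminacy f U)
    {U₁ U₂ : Set (OnePoint ℂ)} (hU₁ : IsOpen U₁) (hU₂ : IsOpen U₂)
    (hsub : U₁ ×ˢ U₂ ⊆ {z | z ∈ U ∧ f z ≠ (ν : OnePoint ℂ)}) :
    MaximalPseudoResolvent.SeparatelyHolomorphicOn (recipSub f ν) U₁ U₂ :=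
  MaximalPseudoResolvent.separatelyHolomorphicOn_of_analytic hU₁ hU₂ fun _ hz =>
    (hf.recipSub_spec (hsub hz).1 (hsub hz).2).1

theorem exists_open_rectangle (hU : IsOpen U) (hf : IsMeromorphicWithoutIndeterminacy f U)
    (hν : ν ∈ resolventDomain f U R₁ R₂) :
    ∃ U₁ U₂ : Set (OnePoint ℂ), IsOpen U₁ ∧ IsOpen U₂ ∧ R₁.extendedSingularSet ⊆ U₁ ∧
      R₂.extendedSingularSet ⊆ U₂ ∧ U₁ ×ˢ U₂ ⊆ {z | z ∈ U ∧ f z ≠ (ν : OnePoint ℂ)} :=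
  generalized_tube_lemma (R₁.isClosed_extendedSingularSet E.full_BX).isCompact
    (R₂.isClosed_extendedSingularSet E.full_BY).isCompact (hf.isOpen_ne hU ν)
    fun z hz => ⟨hν.1 hz, fun h => hν.2 ⟨z, hz, h⟩⟩

theorem exists_admissibleContours (hU : IsOpen U) (hf : IsMeromorphicWithoutIndeterminacy f U)
    (hν : ν ∈ resolventDomain f U R₁ R₂) :
    ∃ Γ₁ Γ₂, AdmissibleContours f U R₁ R₂ ν Γ₁ Γ₂ := by
  obtain ⟨U₁, U₂, hU₁, hU₂, h₁, h₂, hsub⟩ := exists_open_rectangle hU hf hν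
  obtain ⟨Γ₁, hΓ₁⟩ := Contour.exists_isOrientedEnvelope
    (R₁.isClosed_extendedSingularSet E.full_BX) hU₁ h₁
  obtain ⟨Γ₂, hΓ₂⟩ := Contour.exists_isOrientedEnvelope
    (R₂.isClosed_extendedSingularSet E.full_BY) hU₂ h₂
  exact ⟨Γ₁, Γ₂, U₁, U₂, hU₁, hU₂, h₁, h₂, hsub, hΓ₁, hΓ₂⟩

/-- Envelopes relative to U₁ ∩ U₁' and U₂ ∩ U₂' are envelopes for either rectangle, and thus link
the two pairs of contours. -/
theorem calculus_eq_of_admissible (hf : IsMeromorphicWithoutIndeterminacy f U)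
    {Γ₁ Γ₂ Γ₁' Γ₂' : Contour} (h : AdmissibleContours f U R₁ R₂ ν Γ₁ Γ₂)
    (h' : AdmissibleContours f U R₁ R₂ ν Γ₁' Γ₂') :
    E.calculus R₁ R₂ (recipSub f ν) Γ₁ Γ₂ = E.calculus R₁ R₂ (recipSub f ν) Γ₁' Γ₂' := by
  obtain ⟨U₁, U₂, hU₁, hU₂, h₁, h₂, hsub, hΓ₁, hΓ₂⟩ := h
  obtain ⟨U₁', U₂', hU₁', hU₂', h₁', h₂', hsub', hΓ₁', hΓ₂'⟩ := h'
  obtain ⟨Δ₁, hΔ₁⟩ := Contour.exists_isOrientedEnvelope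
    (R₁.isClosed_extendedSingularSet E.full_BX) (hU₁.inter hU₁') (Set.subset_inter h₁ h₁')
  obtain ⟨Δ₂, hΔ₂⟩ := Contour.exists_isOrientedEnvelope
    (R₂.isClosed_extendedSingularSet E.full_BY) (hU₂.inter hU₂') (Set.subset_inter h₂ h₂')
  simp only [calculus_eq_bicalculus]
  rw [MaximalPseudoResolvent.bicalculus_eq_bicalculus E.full_BX E.full_BY
      (separatelyHolomorphicOn_recipSub hf hU₁ hU₂ hsub) hΓ₁ (hΔ₁.mono Set.inter_subset_left) hΓ₂
      (hΔ₂.mono Set.inter_subset_left),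
    MaximalPseudoResolvent.bicalculus_eq_bicalculus E.full_BX E.full_BY
      (separatelyHolomorphicOn_recipSub hf hU₁' hU₂' hsub') hΓ₁' (hΔ₁.mono Set.inter_subset_right)
      hΓ₂' (hΔ₂.mono Set.inter_subset_right)]

theorem isResolventOfFunction_calculus (hf : IsMeromorphicWithoutIndeterminacy f U)
    {Γ₁ Γ₂ : Contour} (h : AdmissibleContours f U R₁ R₂ ν Γ₁ Γ₂) :
    E.IsResolventOfFunction f U R₁ R₂ ν (E.calculus R₁ R₂ (recipSub f ν) Γ₁ Γ₂) :=
  ⟨⟨Γ₁, Γ₂, h⟩, fun _ _ h' => calculus_eq_of_admissible hf h' h⟩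

theorem IsResolventOfFunction.resolventOfFunction {T : Z →L[ℂ] Z}
    (h : E.IsResolventOfFunction f U R₁ R₂ ν T) :
    E.IsResolventOfFunction f U R₁ R₂ ν (E.resolventOfFunction f U R₁ R₂ ν) := by
  have he : ∃ T, E.IsResolventOfFunction f U R₁ R₂ ν T := ⟨T, h⟩
  rw [ExtendedTensorProduct.resolventOfFunction, dif_pos he]
  exact he.choose_spec

theorem resolventOfFunction_eq_calculus (hf : IsMeromorphicWithoutIndeterminacy f U)
    {Γ₁ Γ₂ : Contour} (h : AdmissibleContours f U R₁ R₂ ν Γ₁ Γ₂) :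
    E.resolventOfFunction f U R₁ R₂ ν = E.calculus R₁ R₂ (recipSub f ν) Γ₁ Γ₂ :=
  ((isResolventOfFunction_calculus hf h).resolventOfFunction.2 Γ₁ Γ₂ h).symm

theorem mem_resolventDomain_of_admissible {Γ₁ Γ₂ : Contour}
    (h : AdmissibleContours f U R₁ R₂ ν Γ₁ Γ₂) : ν ∈ resolventDomain f U R₁ R₂ := by
  obtain ⟨U₁, U₂, -, -, h₁, h₂, hsub, -, -⟩ := h
  have h := (Set.prod_mono h₁ h₂).trans hsub
  refine ⟨fun z hz => (h hz).1, ?_⟩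
  rintro ⟨z, hz, e⟩
  exact (h hz).2 e

/-- Contours admissible for the limit are kept. Late singular sets lie in the open set of points of
Uᵢ off Γᵢ that are surrounded once, so the same contours are admissible for them. -/
theorem resolventConvergesAt (hU : IsOpen U) (hf : IsMeromorphicWithoutIndeterminacy f U)
    {Q₁ : ℕ → MaximalPseudoResolvent E.BX} {Q₂ : ℕ → MaximalPseudoResolvent E.BY}
    (hQ₁ : MaximalPseudoResolvent.ConvergesTo Q₁ R₁)
    (hQ₂ : MaximalPseudoResolvent.ConvergesTo Q₂ R₂) (hν : ν ∈ resolventDomain f U R₁ R₂) :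
    E.ResolventConvergesAt f U Q₁ Q₂ R₁ R₂ ν := by
  obtain ⟨Γ₁, Γ₂, hadm⟩ := exists_admissibleContours hU hf hν
  have hR := resolventOfFunction_eq_calculus hf hadm
  obtain ⟨U₁, U₂, hU₁, hU₂, h₁, h₂, hsub, hΓ₁, hΓ₂⟩ := hadm
  have e₁ : ∀ᶠ n in atTop, (Q₁ n).extendedSingularSet ⊆ U₁ ∧
      Γ₁.IsOrientedEnvelope (Q₁ n).extendedSingularSet U₁ᶜ := by
    filter_upwards [hQ₁.eventually_subset E.full_BX (hU₁.inter (Γ₁.isOpen_encloses_eq 1))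
      (Set.subset_inter h₁ hΓ₁.subset)] with n hn
    exact ⟨hn.trans Set.inter_subset_left, hΓ₁.of_subset (hn.trans Set.inter_subset_right)⟩
  have e₂ : ∀ᶠ n in atTop, (Q₂ n).extendedSingularSet ⊆ U₂ ∧
      Γ₂.IsOrientedEnvelope (Q₂ n).extendedSingularSet U₂ᶜ := by
    filter_upwards [hQ₂.eventually_subset E.full_BY (hU₂.inter (Γ₂.isOpen_encloses_eq 1))
      (Set.subset_inter h₂ hΓ₂.subset)] with n hn
    exact ⟨hn.trans Set.inter_subset_left, hΓ₂.of_subset (hn.trans Set.inter_subset_right)⟩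
  have hadmQ : ∀ᶠ n in atTop, AdmissibleContours f U (Q₁ n) (Q₂ n) ν Γ₁ Γ₂ := by
    filter_upwards [e₁, e₂] with n h1 h2
    exact ⟨U₁, U₂, hU₁, hU₂, h1.1, h2.1, hsub, h1.2, h2.2⟩
  refine ⟨?_, ?_⟩
  · filter_upwards [hadmQ] with n hn
    exact ⟨mem_resolventDomain_of_admissible hn,
      (isResolventOfFunction_calculus hf hn).resolventOfFunction⟩
  · rw [hR, calculus_eq_bicalculus]
    refine (MaximalPseudoResolvent.tendsto_bicalculus E.full_BX E.full_BY E.bilinear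
      (separatelyHolomorphicOn_recipSub hf hU₁ hU₂ hsub) hQ₁ hQ₂ hΓ₁ hΓ₂
      (e₁.mono fun _ h => h.2) (e₂.mono fun _ h => h.2)).congr' ?_
    filter_upwards [hadmQ] with n hn
    exact (resolventOfFunction_eq_calculus hf hn).symm

end ExtendedTensorProduct

end TwoVarCalculus

theorem corollaryc {X Y Z : Type*}
    [NormedAddCommGroup X] [NormedSpace ℂ X] [CompleteSpace X]
    [NormedAddCommGroup Y] [NormedSpace ℂ Y] [CompleteSpace Y]
    [NormedAddCommGroup Z] [NormedSpace ℂ Z] [CompleteSpace Z]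
    (E : ExtendedTensorProduct X Y Z)
    (R₁ : MaximalPseudoResolvent E.BX) (R₂ : MaximalPseudoResolvent E.BY)
    (f : OnePoint ℂ × OnePoint ℂ → OnePoint ℂ) (U : Set (OnePoint ℂ × OnePoint ℂ))
    (hU : IsOpen U) (hRU : R₁.extendedSingularSet ×ˢ R₂.extendedSingularSet ⊆ U)
    (hf : IsMeromorphicWithoutIndeterminacy f U)
    (Q₁ Q₁' : ℕ → MaximalPseudoResolvent E.BX) (Q₂ Q₂' : ℕ → MaximalPseudoResolvent E.BY)
    (h₁ : MaximalPseudoResolvent.ConvergesTo Q₁ R₁)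
    (h₁' : MaximalPseudoResolvent.ConvergesTo Q₁' R₁)
    (h₂ : MaximalPseudoResolvent.ConvergesTo Q₂ R₂)
    (h₂' : MaximalPseudoResolvent.ConvergesTo Q₂' R₂) :
    ∀ ν ∈ resolventDomain f U R₁ R₂,
      E.IsResolventOfFunction f U R₁ R₂ ν (E.resolventOfFunction f U R₁ R₂ ν) ∧
      E.ResolventConvergesAt f U Q₁ Q₂ R₁ R₂ ν ∧
      E.ResolventConvergesAt f U Q₁' Q₂' R₁ R₂ ν := by
  intro ν hν
  obtain ⟨Γ₁, Γ₂, hadm⟩ := ExtendedTensorProduct.exists_admissibleContours hU hf hν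
  exact ⟨(ExtendedTensorProduct.isResolventOfFunction_calculus hf hadm).resolventOfFunction,
    ExtendedTensorProduct.resolventConvergesAt hU hf h₁ h₂ hν,
    ExtendedTensorProduct.resolventConvergesAt hU hf h₁' h₂' hν⟩
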